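/- Let $n\ge 0$ be an integer, $\varepsilon\in\{1,-1\}$, and let $A:\mathbb R\to\mathbb R$ be a $C^\infty$ function that tends to $0$ exponentially fast at $+\infty$ and satisfies $$A^{(2n)}(x)=\varepsilon\,x\,A(x)\qquad (x\in\mathbb R);$$ the higher-order Airy function $A=\mathrm{Ai}_{2n+1}$ with $\mathrm{Ai}_{2n+1}^{(2n)}(x)=x\,\mathrm{Ai}_{2n+1}(x)$ is the case $\varepsilon=1$. Let $\sigma:\mathbb R\to\mathbb R$ be nondecreasing with $\sigma(-\infty)=0$ and $\sigma(+\infty)=\gamma\in(0,1]$, and let $\sigma'=d\sigma$ denote its Lebesgue--Stieltjes measure. Fix $s\in\mathbb R$ and suppose that $\int_{\mathbb R}\sigma(r)\,A^{(p)}(s+r)^2\,dr<\infty$ for $0\le p\le 2n$. Let $K_2$ be the integral operator on $L^2(\mathbb R_+)$ with kernel $$K_2(x,y)=\int_{\mathbb R}\sigma(r)\,A(x+s+r)\,A(y+s+r)\,dr ,$$ and suppose that $I-K_2$ is invertible on $L^2(\mathbb R_+)$. For $p\ge 0$ and $t,t'\in\mathbb R$ put $$q_p(t)=A^{(p)}(t+s)+\int_0^\infty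 A^{(p)}(t+s+y)\,\rho(y)\,dy,\qquad \rho=(I-K_2)^{-1}K_2(\cdot,0),$$ $$u_p(t,t')=\int_0^\infty A^{(p)}(t+s+y)\,\bigl[(I-K_2)^{-1}A(\cdot+t'+s)\bigr](y)\,dy ,$$ i.e. $q_p=A_s^{(p)}(I-K_2)^{-1}|\delta\rangle$ and $u_p=A_s^{(p)}(I-K_2)^{-1}A_s^{\mathsf T}$ with $A_s(x,y)=A(x+y+s)$ and $\delta$ the point mass at $0$. Write $$(u_k^{\mathsf T}\sigma' q_m)(t)=\int_{\mathbb R}u_k(v,t)\,q_m(v)\,d\sigma(v),\qquad (Xq_0)(t)=t\,q_0(t).$$ Then all the integrals $u_k^{\mathsf T}\sigma'q_m$ below converge absolutely and, for every $t\in\mathbb R$, $$q_{2n}=\varepsilon\,(s+X)\,q_0-\sum_{\ell=0}^{n-1}\Bigl(u_{2n-1-2\ell}^{\mathsf T}\,\sigma'\,q_{2\ell}-u_{2n-2-2\ell}^{\mathsf T}\,\sigma'\,q_{2\ell+1}\Bigr).$$ In particular, for $\varepsilon=1$, $$q_{2n}=(s+X)\,q_0-\sum_{\ell=0}^{n-1}\Bigl(u_{2n-1-2\ell}^{\mathsf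 T}\,\sigma'\,q_{2\ell}-u_{2n-2-2\ell}^{\mathsf T}\,\sigma'\,q_{2\ell+1}\Bigr).$$ -/

import Mathlib

open MeasureTheory Set Filter Topology
open scoped ContDiff

/-- Lebesgue measure on the half-line `(0, ∞)`. -/
noncomputable abbrev halfLine : Measure ℝ := volume.restrict (Ioi (0 : ℝ))

/-- The real Hilbert space `L²(ℝ₊)`. -/
noncomputable abbrev HalfLineL2 : Type := Lp ℝ 2 halfLine

/-- `T` is the integral operator on `L²(ℝ₊)` with kernel `k`. -/
def IsIntegralOperator (k : ℝ → ℝ → ℝ) (T : HalfLineL2 →L[ℝ] HalfLineL2) : Prop :=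
  ∀ f : HalfLineL2, ∀ᵐ x ∂halfLine,
    Integrable (fun y => k x y * f y) halfLine ∧ T f x = ∫ y, k x y * f y ∂halfLine

open Classical in
/-- The bounded integral operator on `L²(ℝ₊)` with kernel `k` (it is unique; the value is `0` for
kernels that do not define a bounded operator). -/
noncomputable def integralOperator (k : ℝ → ℝ → ℝ) : HalfLineL2 →L[ℝ] HalfLineL2 :=
  if h : ∃ T, IsIntegralOperator k T then h.choose else 0

theorem integralOperator_eq {k : ℝ → ℝ → ℝ} {T : HalfLineL2 →L[ℝ] HalfLineL2}
    (hT : IsIntegralOperator k T) : integralOperator k = T := by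
  have h : ∃ T, IsIntegralOperator k T := ⟨T, hT⟩
  unfold integralOperator
  rw [dif_pos h]
  ext1 f
  apply Lp.ext
  filter_upwards [h.choose_spec f, hT f] with x h1 h2
  rw [h1.2, h2.2]

open Classical in
/-- The class in `L²(ℝ₊)` of a function (`0` if the function is not square integrable on `ℝ₊`). -/
noncomputable def toHalfLineL2 (f : ℝ → ℝ) : HalfLineL2 :=
  if h : MemLp f 2 halfLine then h.toLp f else 0

/-- The kernel `K₂(x,y) = ∫_ℝ σ(r) A(x+s+r) A(y+s+r) dr`. -/
noncomputable def kernelK2 (A σ : ℝ → ℝ) (s x y : ℝ) : ℝ :=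
  ∫ r, σ r * A (x + s + r) * A (y + s + r)

/-- The operator `K₂ = A_sᵀ σ A_s` on `L²(ℝ₊)`. -/
noncomputable def opK2 (A σ : ℝ → ℝ) (s : ℝ) : HalfLineL2 →L[ℝ] HalfLineL2 :=
  integralOperator (kernelK2 A σ s)

/-- The operator `(I - K₂)⁻¹` on `L²(ℝ₊)`. -/
noncomputable def resolventK2 (A σ : ℝ → ℝ) (s : ℝ) : HalfLineL2 →L[ℝ] HalfLineL2 :=
  Ring.inverse (1 - opK2 A σ s)

/-- The regular part `ρ = (I - K₂)⁻¹ K₂ δ` of `(I - K₂)⁻¹ δ = δ + ρ`, where `δ` is the point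
evaluation at `0`, so that `K₂ δ` is the function `K₂(·, 0)`. -/
noncomputable def resolventDelta (A σ : ℝ → ℝ) (s : ℝ) : HalfLineL2 :=
  resolventK2 A σ s (toHalfLineL2 (fun y => kernelK2 A σ s y 0))

/-- `q_p = A_s^{(p)} (I - K₂)⁻¹ δ`, that is
`q_p(t) = ∫_{ℝ₊} A^{(p)}(t+s+y) (I - K₂)⁻¹(y,0) dy` with `(I - K₂)⁻¹(y,0) = δ(y) + ρ(y)`. -/
noncomputable def qFun (A σ : ℝ → ℝ) (s : ℝ) (p : ℕ) (t : ℝ) : ℝ :=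
  iteratedDeriv p A (t + s)
    + ∫ y, iteratedDeriv p A (t + s + y) * resolventDelta A σ s y ∂halfLine

/-- `u_p = A_s^{(p)} (I - K₂)⁻¹ A_sᵀ`, as a kernel in `(t, t')`. -/
noncomputable def uFun (A σ : ℝ → ℝ) (s : ℝ) (p : ℕ) (t t' : ℝ) : ℝ :=
  ∫ y, iteratedDeriv p A (t + s + y)
    * resolventK2 A σ s (toHalfLineL2 (fun z => A (z + t' + s))) y ∂halfLine

/-- The measure `σ'`, i.e. the Lebesgue–Stieltjes measure `dσ` (jumps of `σ` give point masses). -/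
noncomputable def sigmaPrime {σ : ℝ → ℝ} (hσ : Monotone σ) : Measure ℝ :=
  hσ.stieltjesFunction.measure

/-- `(u_pᵀ σ' q_m)(t) = ∫_ℝ u_p(v,t) q_m(v) dσ(v)`. -/
noncomputable def uTransposeSigmaQ (A : ℝ → ℝ) {σ : ℝ → ℝ} (hσ : Monotone σ) (s : ℝ) (p m : ℕ)
    (t : ℝ) : ℝ :=
  ∫ v, uFun A σ s p v t * qFun A σ s m v ∂(sigmaPrime hσ)

/-! Put `a_p(x) = A^{(p)}(s + x)` and give the half-line the measure `δ₀ + dy`. On it `(I - K₂)⁻¹ δ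
= δ + ρ` becomes a function `r` with `r(0) = 1` and `r = ρ` on `(0, ∞)`, while `f = (I - K₂)⁻¹ a₀(t
+ ·)` gets `f(0) = 0`. Then `q_p` and `u_p(·, t)` are the transforms `airyTransform a p r` and
`airyTransform a p f`.

The sum in the theorem integrates against `dσ` the bilinear concomitant `C` of these transforms. Its
derivative telescopes to `u_{2n} q_0 - u_0 q_{2n}` and `C` vanishes at `+∞`, so `∫ C dσ = -∫ σ C'
dv`. In `C'` the ODE replaces each order `2n` by multiplication with `ε (v + s + y)` under the
integral; the `v + s` parts cancel, leaving transforms of `y f` and `y r`. Fubini gives `∫ σ ĥ k̂ =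
⟨h, K k⟩`, with hats for order-zero transforms. On `(0, ∞)`, `K r = r` and `K f = f - a₀(t + ·)`;
the factor `y` kills the atom at `0`. The two copies of `∫ y f r` cancel, and what survives is `-ε ∫
a₀(t + y) y r`, which is minus the excess of `q_{2n}(t)` over `ε (s + t) q_0(t)`.

The analytic difficulty is that multiplication by `y` must be controlled using only `∫ σ a_p² < ∞`.
The key estimate `moment_two_zero_zero_le` bounds `∫_v^∞ (x - v)² a₀²` by the unweighted energies of
`a_0, …, a_{2n}`. It yields `∫ σ(v) ∫ (1 + z) a₀(v + z)² < ∞`, hence `pairing` and, through the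
resolvent equation, `isWeightedL2_extendHalfLine`. The algebra is assembled in
`integral_concomitant_eq`. -/

/-! ### Exponential decay at `+∞`. -/

/-- `f` decays at least exponentially at `+∞`. -/
def ExpDecay (f : ℝ → ℝ) : Prop :=
  ∃ b : ℝ, 0 < b ∧ f =O[atTop] fun x => Real.exp (-b * x)

namespace ExpDecay

variable {f g F : ℝ → ℝ}

theorem isBigO_exp_of_le {b c : ℝ} (h : b ≤ c) :
    (fun x : ℝ => Real.exp (-c * x)) =O[atTop] fun x => Real.exp (-b * x) := by
  apply Asymptotics.IsBigO.of_bound 1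
  filter_upwards [eventually_ge_atTop 0] with x hx
  rw [Real.norm_eq_abs, Real.norm_eq_abs, Real.abs_exp, Real.abs_exp, one_mul]
  exact Real.exp_le_exp.2 (by nlinarith)

theorem add (hf : ExpDecay f) (hg : ExpDecay g) : ExpDecay fun x => f x + g x := by
  obtain ⟨b, hb, hf⟩ := hf
  obtain ⟨c, hc, hg⟩ := hg
  exact ⟨min b c, lt_min hb hc, (hf.trans (isBigO_exp_of_le (min_le_left _ _))).add
    (hg.trans (isBigO_exp_of_le (min_le_right _ _)))⟩

theorem const_mul (hf : ExpDecay f) (k : ℝ) : ExpDecay fun x => k * f x := by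
  obtain ⟨b, hb, hf⟩ := hf
  exact ⟨b, hb, hf.const_mul_left k⟩

theorem sub (hf : ExpDecay f) (hg : ExpDecay g) : ExpDecay fun x => f x - g x := by
  simpa [sub_eq_add_neg] using hf.add (hg.const_mul (-1))

theorem tendsto_zero (hf : ExpDecay f) : Tendsto f atTop (𝓝 0) := by
  obtain ⟨b, hb, hf⟩ := hf
  apply hf.trans_tendsto
  have h : Tendsto (fun x : ℝ => b * x) atTop atTop := tendsto_id.const_mul_atTop hb
  simpa [Function.comp_def] using Real.tendsto_exp_neg_atTop_nhds_zero.comp h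

theorem mul (hf : ExpDecay f) (hg : ExpDecay g) : ExpDecay fun x => f x * g x := by
  have h := hg.tendsto_zero.isBigO_one ℝ
  obtain ⟨b, hb, hf⟩ := hf
  exact ⟨b, hb, by simpa using hf.mul h⟩

theorem id_mul (hf : ExpDecay f) : ExpDecay fun x => x * f x := by
  obtain ⟨b, hb, hf⟩ := hf
  -- Half of the rate pays for the linear factor.
  refine ⟨b / 2, half_pos hb, ?_⟩
  have h : (fun x : ℝ => x) =O[atTop] fun x => Real.exp (b / 2 * x) := by
    simpa using (isLittleO_pow_exp_pos_mul_atTop 1 (half_pos hb)).isBigO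
  refine (h.mul hf).congr_right fun x => ?_
  rw [← Real.exp_add]
  congr 1
  ring

theorem sub_const_mul (hf : ExpDecay f) (k : ℝ) : ExpDecay fun x => (x - k) * f x := by
  simpa [sub_mul] using hf.id_mul.sub (hf.const_mul k)

theorem sub_const_pow_mul (hf : ExpDecay f) (k : ℝ) (m : ℕ) :
    ExpDecay fun x => (x - k) ^ m * f x := by
  induction m with
  | zero => simpa using hf
  | succ m ih => simpa [pow_succ', mul_assoc] using ih.sub_const_mul k

theorem integrableOn_Ioi (hf : ExpDecay f) (hc : Continuous f) (v : ℝ) :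
    IntegrableOn f (Ioi v) := by
  obtain ⟨b, hb, hf⟩ := hf
  exact integrable_of_isBigO_exp_neg hb hc.continuousOn hf

theorem exists_bound (hf : ExpDecay f) (hc : Continuous f) (v : ℝ) :
    ∃ C c : ℝ, 0 < c ∧ 0 ≤ C ∧ ∀ x, v ≤ x → |f x| ≤ C * Real.exp (-c * x) := by
  obtain ⟨b, hb, hf⟩ := hf
  obtain ⟨C, hC⟩ := hf.bound
  obtain ⟨X, hX⟩ := eventually_atTop.1 hC
  have hcont : Continuous fun x => f x * Real.exp (b * x) := by fun_prop
  obtain ⟨D, hD⟩ := (isCompact_Icc (a := v) (b := X)).exists_bound_of_continuousOn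
    hcont.continuousOn
  refine ⟨max (max C D) 0, b, hb, le_max_right _ _, fun x hx => ?_⟩
  rcases le_total X x with h | h
  · refine (hX x h).trans ?_
    rw [Real.norm_eq_abs, Real.abs_exp]
    gcongr
    exact (le_max_left _ _).trans (le_max_left _ _)
  · have h1 := hD x ⟨hx, h⟩
    rw [Real.norm_eq_abs, abs_mul, Real.abs_exp] at h1
    have h2 : |f x| = |f x| * Real.exp (b * x) * Real.exp (-b * x) := by
      rw [mul_assoc, ← Real.exp_add]; simp
    rw [h2]
    gcongr
    exact h1.trans ((le_max_right _ _).trans (le_max_left _ _))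

/-- Integrability of `f` gives `F` a limit `L`, and `F - L` is minus a tail integral of `f`, which
decays at the same rate. -/
theorem exists_sub_const (hf : ExpDecay f) (hc : Continuous f)
    (hF : ∀ x, HasDerivAt F (f x) x) : ∃ L, ExpDecay fun x => F x - L := by
  have hlim := tendsto_limUnder_of_hasDerivAt_of_integrableOn_Ioi (a := 0)
    (fun x _ => hF x) (hf.integrableOn_Ioi hc 0)
  set L := limUnder atTop F
  obtain ⟨C, c, hc0, hC0, hC⟩ := hf.exists_bound hc 0
  refine ⟨L, c, hc0, Asymptotics.IsBigO.of_bound (C / c) ?_⟩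
  filter_upwards [eventually_ge_atTop 0] with x hx
  have h := integral_Ioi_of_hasDerivAt_of_tendsto (a := x)
    (hF x).continuousAt.continuousWithinAt (fun y _ => hF y) (hf.integrableOn_Ioi hc x) hlim
  have h2 : ‖∫ y in Ioi x, f y‖ ≤ ∫ y in Ioi x, C * Real.exp (-c * y) := by
    apply norm_integral_le_of_norm_le ((exp_neg_integrableOn_Ioi x hc0).const_mul C)
    filter_upwards [ae_restrict_mem measurableSet_Ioi] with y hy
    exact hC y (hx.trans (le_of_lt hy))
  rw [integral_const_mul, integral_exp_mul_Ioi (by linarith : -c < 0), h] at h2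
  rw [norm_sub_rev]
  refine h2.trans (le_of_eq ?_)
  rw [Real.norm_eq_abs, Real.abs_exp]
  field_simp

end ExpDecay

/-! ### Decay of intermediate derivatives. -/

theorem Polynomial.exists_derivative_eq (P : Polynomial ℝ) :
    ∃ Q : Polynomial ℝ, Polynomial.derivative Q = P := by
  induction P using Polynomial.induction_on' with
  | add P R hP hR =>
    obtain ⟨Q, rfl⟩ := hP
    obtain ⟨S, rfl⟩ := hR
    exact ⟨Q + S, by simp⟩
  | monomial n c =>
    refine ⟨Polynomial.monomial (n + 1) (c / (n + 1)), ?_⟩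
    rw [Polynomial.derivative_monomial]
    congr 1
    push_cast
    field_simp

/-- Integrate `N` times: each integration preserves decay up to a constant, and these constants
build up a polynomial. The sequence is quantified after `N` so that the induction hypothesis applies
to its shift. -/
theorem exists_polynomial_sub_expDecay (N : ℕ) : ∀ (a : ℕ → ℝ → ℝ),
    (∀ p x, HasDerivAt (a p) (a (p + 1) x) x) → ExpDecay (a N) →
    ∃ P : Polynomial ℝ, ∀ p ≤ N,
      ExpDecay fun x => a p x - (Polynomial.derivative^[p] P).eval x := by
  induction N with
  | zero =>
    intro a _ h
    refine ⟨0, fun p hp => ?_⟩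
    obtain rfl := Nat.le_zero.1 hp
    simpa using h
  | succ N ih =>
    intro a ha h
    obtain ⟨P, hP⟩ := ih (fun p => a (p + 1)) (fun p => ha (p + 1)) h
    obtain ⟨Q, rfl⟩ := Polynomial.exists_derivative_eq P
    have hd : ∀ x, HasDerivAt (fun x => a 0 x - Q.eval x)
        (a 1 x - (Polynomial.derivative Q).eval x) x := fun x => (ha 0 x).sub (Q.hasDerivAt x)
    have hc : Continuous fun x => a 1 x - (Polynomial.derivative Q).eval x :=
      (continuous_iff_continuousAt.2 fun x => (ha 1 x).continuousAt).sub
        (Polynomial.continuous _)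
    obtain ⟨L, hL⟩ := (hP 0 (Nat.zero_le _)).exists_sub_const hc hd
    refine ⟨Q + Polynomial.C L, fun p hp => ?_⟩
    cases p with
    | zero => simpa [sub_sub] using hL
    | succ p =>
      have := hP p (Nat.le_of_succ_le_succ hp)
      simpa [Function.iterate_succ_apply] using this

/-- A polynomial that tends to `0` at infinity is zero, so decay at the two ends of the chain of
derivatives forces decay in between. -/
theorem expDecay_of_tendsto_zero {N : ℕ} {a : ℕ → ℝ → ℝ}
    (ha : ∀ p x, HasDerivAt (a p) (a (p + 1) x) x) (h0 : Tendsto (a 0) atTop (𝓝 0))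
    (hN : ExpDecay (a N)) {p : ℕ} (hp : p ≤ N) : ExpDecay (a p) := by
  obtain ⟨P, hP⟩ := exists_polynomial_sub_expDecay N a ha hN
  have h1 : Tendsto (fun x => P.eval x) atTop (𝓝 0) := by
    simpa using h0.sub (hP 0 (Nat.zero_le _)).tendsto_zero
  have h2 : P = 0 := by
    have := (Polynomial.tendsto_nhds_iff P).1 h1
    simpa using this.1
  simpa [h2] using hP p hp

/-! ### The Airy system. -/

/-- The derivatives `a p = a₀^{(p)}` of an exponentially decaying solution of
`a₀^{(2n)}(x) = ε (x + s) a₀(x)`. -/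
structure IsAirySystem (n : ℕ) (ε s : ℝ) (a : ℕ → ℝ → ℝ) : Prop where
  hasDerivAt : ∀ p x, HasDerivAt (a p) (a (p + 1) x) x
  ode : ∀ x, a (2 * n) x = ε * ((x + s) * a 0 x)
  sq_eq_one : ε ^ 2 = 1
  expDecay : ∀ p ≤ 2 * n, ExpDecay (a p)

theorem IsAirySystem.continuous {n : ℕ} {ε s : ℝ} {a : ℕ → ℝ → ℝ} (h : IsAirySystem n ε s a)
    (p : ℕ) : Continuous (a p) :=
  continuous_iff_continuousAt.2 fun x => (h.hasDerivAt p x).continuousAt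

theorem isAirySystem_iteratedDeriv {n : ℕ} {A : ℝ → ℝ} {ε : ℝ} (s : ℝ)
    (hε : ε = 1 ∨ ε = -1) (hA : ContDiff ℝ ∞ A)
    (hdecay : ∃ C c : ℝ, 0 < c ∧ ∀ x : ℝ, 0 ≤ x → |A x| ≤ C * Real.exp (-(c * x)))
    (hODE : ∀ x : ℝ, iteratedDeriv (2 * n) A x = ε * (x * A x)) :
    IsAirySystem n ε s fun p x => iteratedDeriv p A (s + x) := by
  have hderiv : ∀ p x, HasDerivAt (fun x => iteratedDeriv p A (s + x))
      (iteratedDeriv (p + 1) A (s + x)) x := by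
    intro p x
    have h1 : DifferentiableAt ℝ (iteratedDeriv p A) (s + x) :=
      (hA.differentiable_iteratedDeriv p (by exact_mod_cast WithTop.coe_lt_top _)).differentiableAt
    rw [iteratedDeriv_succ]
    exact h1.hasDerivAt.comp_const_add s x
  have h0 : ExpDecay fun x => iteratedDeriv 0 A (s + x) := by
    obtain ⟨C, c, hc, hC⟩ := hdecay
    refine ⟨c, hc, Asymptotics.IsBigO.of_bound (C * Real.exp (-(c * s))) ?_⟩
    filter_upwards [eventually_ge_atTop (-s)] with x hx
    rw [Real.norm_eq_abs, Real.norm_eq_abs, Real.abs_exp, iteratedDeriv_zero]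
    refine (hC (s + x) (by linarith)).trans (le_of_eq ?_)
    rw [mul_assoc, ← Real.exp_add]
    congr 2
    ring
  have hode : ∀ x, iteratedDeriv (2 * n) A (s + x)
      = ε * ((x + s) * iteratedDeriv 0 A (s + x)) := by
    intro x
    rw [hODE, iteratedDeriv_zero, add_comm s x]
  refine ⟨hderiv, hode, by rcases hε with rfl | rfl <;> norm_num, fun p hp =>
    expDecay_of_tendsto_zero hderiv h0.tendsto_zero ?_ hp⟩
  -- By the ODE the derivative of order `2n` is `a₀` times a linear factor, so it decays too.
  have h2 := (h0.sub_const_mul (-s)).const_mul ε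
  simp only [sub_neg_eq_add] at h2
  exact (funext hode : (fun x => iteratedDeriv (2 * n) A (s + x)) = _) ▸ h2

/-! ### Moment estimates on `(v, ∞)`. -/

namespace IsAirySystem

/-- `∫_v^∞ (x - v)^m a_i(x) a_j(x) dx`. -/
noncomputable def moment (a : ℕ → ℝ → ℝ) (v : ℝ) (m i j : ℕ) : ℝ :=
  ∫ x in Ioi v, (x - v) ^ m * (a i x * a j x)

/-- `∑_{p ≤ 2n} ∫_v^∞ a_p(x)² dx`. -/
noncomputable def energy (n : ℕ) (a : ℕ → ℝ → ℝ) (v : ℝ) : ℝ :=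
  ∑ p ∈ Finset.range (2 * n + 1), ∫ x in Ioi v, a p x ^ 2

variable {n : ℕ} {ε s : ℝ} {a : ℕ → ℝ → ℝ}

theorem integrableOn_moment (h : IsAirySystem n ε s a) (v : ℝ) (m : ℕ) {i j : ℕ}
    (hi : i ≤ 2 * n) (hj : j ≤ 2 * n) :
    IntegrableOn (fun x => (x - v) ^ m * (a i x * a j x)) (Ioi v) := by
  have hi' := h.continuous i
  have hj' := h.continuous j
  exact (((h.expDecay i hi).mul (h.expDecay j hj)).sub_const_pow_mul v m).integrableOn_Ioi
    (by fun_prop) v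

theorem moment_comm (v : ℝ) (m i j : ℕ) : moment a v m i j = moment a v m j i := by
  simp only [moment, mul_comm (a i _)]

/-- Integration by parts. The exponent `m + 1 > 0` removes the boundary term at `v`. -/
theorem moment_succ (h : IsAirySystem n ε s a) (v : ℝ) (m : ℕ) {i j : ℕ}
    (hi : i + 1 ≤ 2 * n) (hj : j + 1 ≤ 2 * n) :
    moment a v (m + 1) (i + 1) j
      = -moment a v (m + 1) i (j + 1) - (m + 1) * moment a v m i j := by
  have i0 := (h.integrableOn_moment v m (i := i) (j := j) (by omega) (by omega)).const_mul
    ((m : ℝ) + 1)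
  have i1 := h.integrableOn_moment v (m + 1) (i := i + 1) (j := j) hi (by omega)
  have i2 := h.integrableOn_moment v (m + 1) (i := i) (j := j + 1) (by omega) hj
  have hd : ∀ x, HasDerivAt (fun x => (x - v) ^ (m + 1) * (a i x * a j x))
      ((((m : ℝ) + 1) * ((x - v) ^ m * (a i x * a j x)))
        + ((x - v) ^ (m + 1) * (a (i + 1) x * a j x)
        + (x - v) ^ (m + 1) * (a i x * a (j + 1) x))) x := by
    intro x
    have h1 := (((hasDerivAt_id x).sub_const v).pow (m + 1)).mul
      ((h.hasDerivAt i x).mul (h.hasDerivAt j x))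
    refine h1.congr_deriv ?_
    simp only [id, Nat.add_sub_cancel, Pi.mul_apply, Pi.pow_apply]
    push_cast
    ring
  have hlim := ((((h.expDecay i (by omega)).mul (h.expDecay j (by omega))).sub_const_pow_mul v
    (m + 1))).tendsto_zero
  have key := integral_Ioi_of_hasDerivAt_of_tendsto (a := v)
    (hd v).continuousAt.continuousWithinAt (fun x _ => hd x) (i0.fun_add (i1.fun_add i2)) hlim
  rw [integral_add i0 (i1.fun_add i2), integral_add i1 i2, integral_const_mul] at key
  simp only [sub_self, ne_eq, Nat.add_eq_zero_iff, one_ne_zero, and_false, not_false_eq_true,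
    zero_pow, zero_mul] at key
  unfold moment
  linarith

theorem integral_sq_le_energy (v : ℝ) {i : ℕ} (hi : i ≤ 2 * n) :
    ∫ x in Ioi v, a i x ^ 2 ≤ energy n a v :=
  Finset.single_le_sum (f := fun p => ∫ x in Ioi v, a p x ^ 2)
    (fun _ _ => integral_nonneg fun _ => sq_nonneg _) (Finset.mem_range.2 (by omega))

theorem energy_nonneg (v : ℝ) : 0 ≤ energy n a v :=
  Finset.sum_nonneg fun _ _ => integral_nonneg fun _ => sq_nonneg _

theorem integrableOn_sq (h : IsAirySystem n ε s a) (v : ℝ) {i : ℕ} (hi : i ≤ 2 * n) :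
    IntegrableOn (fun x => a i x ^ 2) (Ioi v) := by
  simpa [sq] using h.integrableOn_moment v 0 hi hi

theorem abs_moment_zero_le (h : IsAirySystem n ε s a) (v : ℝ) {i j : ℕ}
    (hi : i ≤ 2 * n) (hj : j ≤ 2 * n) : |moment a v 0 i j| ≤ energy n a v := by
  have h1 : ‖∫ x in Ioi v, (x - v) ^ 0 * (a i x * a j x)‖
      ≤ ∫ x in Ioi v, (1 / 2) * (a i x ^ 2 + a j x ^ 2) := by
    apply norm_integral_le_of_norm_le
      (((h.integrableOn_sq v hi).fun_add (h.integrableOn_sq v hj)).const_mul _)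
    refine Eventually.of_forall fun x => ?_
    rw [Real.norm_eq_abs, pow_zero, one_mul, abs_le]
    constructor <;> nlinarith [sq_nonneg (a i x + a j x), sq_nonneg (a i x - a j x)]
  rw [integral_const_mul, integral_add (h.integrableOn_sq v hi) (h.integrableOn_sq v hj),
    Real.norm_eq_abs] at h1
  unfold moment
  linarith [integral_sq_le_energy (a := a) v hi, integral_sq_le_energy (a := a) v hj]

/-- Each derivative moved across flips the sign and costs one unweighted moment, at most one energy.
-/
theorem abs_moment_one_sub_le (h : IsAirySystem n ε s a) (v : ℝ) (k : ℕ) :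
    ∀ j, k + j = 2 * n →
    |moment a v 1 k j - (-1) ^ k * moment a v 1 0 (2 * n)| ≤ k * energy n a v := by
  induction k with
  | zero =>
    intro j hj
    obtain rfl : j = 2 * n := by omega
    simp
  | succ k ih =>
    intro j hj
    have h1 := ih (j + 1) (by omega)
    have h2 := h.moment_succ v 0 (i := k) (j := j) (by omega) (by omega)
    have h3 := h.abs_moment_zero_le v (i := k) (j := j) (by omega) (by omega)
    rw [zero_add, Nat.cast_zero, zero_add, one_mul] at h2
    rw [h2, pow_succ]
    push_cast
    rw [abs_le] at *
    constructor <;> linarith [h1.1, h1.2, h3.1, h3.2]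

/-- Each derivative moved across costs twice a first moment, which is `± moment a v 1 0 (2 * n)` up
to `2n` energies. The main parts accumulate as `2k`, the errors as `4n` per move. -/
theorem abs_moment_two_sub_le (h : IsAirySystem n ε s a) (v : ℝ) (k : ℕ) :
    ∀ j, k + j = 2 * n → 1 ≤ j →
    |moment a v 2 (k + 1) j
      - (-1) ^ k * (moment a v 2 1 (2 * n) - 2 * k * moment a v 1 0 (2 * n))|
      ≤ 4 * n * k * energy n a v := by
  induction k with
  | zero =>
    intro j hj _
    obtain rfl : j = 2 * n := by omega
    simp
  | succ k ih =>
    intro j hj hj1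
    have h1 := ih (j + 1) (by omega) (by omega)
    have h2 := h.moment_succ v 1 (i := k + 1) (j := j) (by omega) (by omega)
    have h3 := h.abs_moment_one_sub_le v (k + 1) j (by omega)
    have h4 : ((k + 1 : ℕ) : ℝ) * energy n a v ≤ 2 * n * energy n a v := by
      refine mul_le_mul_of_nonneg_right ?_ (energy_nonneg v)
      exact_mod_cast (by omega : k + 1 ≤ 2 * n)
    rw [Nat.cast_one, show (1 : ℝ) + 1 = 2 by norm_num, show 1 + 1 = 2 from rfl] at h2
    rw [h2]
    rw [pow_succ] at h3 ⊢
    push_cast at h3 h4 ⊢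
    rw [abs_le] at *
    constructor <;> linarith [h1.1, h1.2, h3.1, h3.2]

/-- Integrate the derivative of `(x - v)² (x + s) a₀²`, trading `(x + s) a₀` for `ε a_{2n}`. The
term in which `x + s` is differentiated produces the wanted second moment. -/
theorem moment_two_one_last (h : IsAirySystem n ε s a) (hn : 1 ≤ n) (v : ℝ) :
    2 * moment a v 2 1 (2 * n) = -ε * (2 * (ε * moment a v 1 0 (2 * n)) + moment a v 2 0 0) := by
  have hε := h.sq_eq_one
  have hode : ∀ x, (x + s) * a 0 x = ε * a (2 * n) x := fun x => by
    rw [h.ode x]; linear_combination (-(x + s) * a 0 x) * hε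
  have i0 := (h.integrableOn_moment v 1 (i := 0) (j := 2 * n) (by omega) (by omega)).const_mul
    (2 * ε)
  have i1 := h.integrableOn_moment v 2 (i := 0) (j := 0) (by omega) (by omega)
  have i2 := (h.integrableOn_moment v 2 (i := 1) (j := 2 * n) (by omega) (by omega)).const_mul
    (2 * ε)
  have hd : ∀ x, HasDerivAt (fun x => (x - v) ^ 2 * ((x + s) * (a 0 x * a 0 x)))
      (2 * ε * ((x - v) ^ 1 * (a 0 x * a (2 * n) x)) + ((x - v) ^ 2 * (a 0 x * a 0 x)
        + 2 * ε * ((x - v) ^ 2 * (a 1 x * a (2 * n) x)))) x := by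
    intro x
    have h1 := (((hasDerivAt_id x).sub_const v).pow 2).mul
      (((hasDerivAt_id x).add_const s).mul ((h.hasDerivAt 0 x).mul (h.hasDerivAt 0 x)))
    refine h1.congr_deriv ?_
    simp only [id, Pi.mul_apply, Pi.pow_apply]
    push_cast
    linear_combination (2 * (x - v) * a 0 x + 2 * (x - v) ^ 2 * a 1 x) * hode x
  have hdec := h.expDecay 0 (by omega)
  have hlim : Tendsto (fun x => (x - v) ^ 2 * ((x + s) * (a 0 x * a 0 x))) atTop (𝓝 0) := by
    simpa [sub_neg_eq_add] using
      (((hdec.mul hdec).sub_const_mul (-s)).sub_const_pow_mul v 2).tendsto_zero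
  have key := integral_Ioi_of_hasDerivAt_of_tendsto (a := v)
    (hd v).continuousAt.continuousWithinAt (fun x _ => hd x) (i0.fun_add (i1.fun_add i2)) hlim
  rw [integral_add i0 (i1.fun_add i2), integral_add i1 i2, integral_const_mul,
    integral_const_mul] at key
  simp only [sub_self, ne_eq, OfNat.ofNat_ne_zero, not_false_eq_true, zero_pow, zero_mul] at key
  change 2 * ε * moment a v 1 0 (2 * n) + (moment a v 2 0 0
    + 2 * ε * moment a v 2 1 (2 * n)) = 0 at key
  linear_combination ε * key - (2 * moment a v 2 1 (2 * n)) * hε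

/-- The second moment `L` is expressed by `Y = moment a v 2 1 (2 * n)` and `X = moment a v 1 0 (2 *
n)`. Moving derivatives gives `Y ≈ (2n - 1) X`, so `L ≈ -4nεX` up to energies, and Cauchy–Schwarz
absorbs `X` into `L / 2`. -/
theorem moment_two_zero_zero_le (h : IsAirySystem n ε s a) (v : ℝ) :
    moment a v 2 0 0 ≤ 32 * (n : ℝ) ^ 2 * energy n a v := by
  have hε := h.sq_eq_one
  -- For `n = 0` the equation is algebraic and forces `a₀ = 0` except possibly where `x + s = ±1`.
  rcases Nat.eq_zero_or_pos n with rfl | hn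
  · have h0 : moment a v 2 0 0 = 0 := by
      refine (integral_congr_ae ?_).trans (integral_zero ℝ ℝ)
      have h1 : ∀ᵐ x : ℝ, x ≠ 1 - s := by simp [ae_iff]
      have h2 : ∀ᵐ x : ℝ, x ≠ -1 - s := by simp [ae_iff]
      filter_upwards [ae_restrict_of_ae h1, ae_restrict_of_ae h2] with x hx1 hx2
      have h3 := h.ode x
      simp only [mul_zero] at h3
      have h4 : a 0 x * ((x + s - 1) * (x + s + 1)) = 0 := by
        linear_combination (-1 - ε * (x + s)) * h3 - (x + s) ^ 2 * a 0 x * hε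
      rcases mul_eq_zero.1 h4 with h4 | h4
      · simp [h4]
      · rcases mul_eq_zero.1 h4 with h4 | h4
        · exact absurd (by linarith) hx1
        · exact absurd (by linarith) hx2
    rw [h0]
    simp
  · have hY := h.moment_two_one_last hn v
    -- After `2n - 1` moves the indices `(1, 2n)` have become `(2n, 1)`: the same integral, but with
    -- an odd sign, so `2Y` is determined by `X` up to energies.
    have hk := h.abs_moment_two_sub_le v (2 * n - 1) 1 (by omega) le_rfl
    have hodd : (-1 : ℝ) ^ (2 * n - 1) = -1 := Odd.neg_one_pow ⟨n - 1, by omega⟩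
    rw [show 2 * n - 1 + 1 = 2 * n by omega, moment_comm v 2 (2 * n) 1, hodd,
      Nat.cast_sub (by omega)] at hk
    push_cast at hk
    have hX : 4 * n * |moment a v 1 0 (2 * n)|
        ≤ (1 / 2) * moment a v 2 0 0 + 8 * n ^ 2 * energy n a v := by
      have i1 := h.integrableOn_moment v 2 (i := 0) (j := 0) (by omega) (by omega)
      have i2 := h.integrableOn_sq v (i := 2 * n) le_rfl
      have h1 : ‖∫ x in Ioi v, 4 * n * ((x - v) ^ 1 * (a 0 x * a (2 * n) x))‖
          ≤ ∫ x in Ioi v, ((1 / 2) * ((x - v) ^ 2 * (a 0 x * a 0 x))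
            + 8 * n ^ 2 * a (2 * n) x ^ 2) := by
        apply norm_integral_le_of_norm_le ((i1.const_mul _).fun_add (i2.const_mul _))
        refine Eventually.of_forall fun x => ?_
        simp only [Real.norm_eq_abs, abs_le]
        constructor <;> nlinarith [sq_nonneg ((x - v) * a 0 x - 4 * n * a (2 * n) x),
          sq_nonneg ((x - v) * a 0 x + 4 * n * a (2 * n) x)]
      rw [integral_add (i1.const_mul _) (i2.const_mul _), integral_const_mul, integral_const_mul,
        integral_const_mul, norm_mul, Real.norm_eq_abs, abs_of_nonneg (by positivity)] at h1
      have h2 := mul_le_mul_of_nonneg_left (integral_sq_le_energy (a := a) v (le_refl (2 * n)))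
        (by positivity : (0 : ℝ) ≤ 8 * n ^ 2)
      unfold moment
      rw [Real.norm_eq_abs] at h1
      linarith
    set X := moment a v 1 0 (2 * n)
    set Y := moment a v 2 1 (2 * n)
    set L := moment a v 2 0 0
    have hE := energy_nonneg (n := n) (a := a) v
    have hn1 : (1 : ℝ) ≤ n := by exact_mod_cast hn
    have hL : L = -ε * (2 * Y - 2 * (2 * n - 1) * X) - 4 * n * (ε * X) := by
      linear_combination ε * hY - (L + 2 * ε * X) * hε
    have habs : |ε| = 1 := by
      rw [← sq_abs] at hε
      nlinarith [abs_nonneg ε]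
    have h3 : |L| ≤ 4 * n * (2 * n - 1) * energy n a v + 4 * n * |X| := by
      rw [hL]
      refine (abs_sub _ _).trans (add_le_add ?_ ?_)
      · rw [abs_mul, abs_neg, habs, one_mul]
        refine le_trans (le_of_eq ?_) hk
        congr 1
        ring
      · rw [abs_mul, abs_mul ε, habs, one_mul, abs_of_nonneg (by positivity : (0 : ℝ) ≤ 4 * n)]
    have h4 := le_abs_self L
    nlinarith [mul_nonneg (by linarith : (0 : ℝ) ≤ n) hE]

end IsAirySystem

/-! ### Tonelli and tail integrals against `dσ`. -/

/-- The measure `δ₀ + dx` on the closed half-line. -/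
noncomputable abbrev pointedHalfLine : Measure ℝ := Measure.dirac 0 + halfLine

theorem lintegral_pointedHalfLine (f : ℝ → ENNReal) :
    ∫⁻ z, f z ∂pointedHalfLine = f 0 + ∫⁻ z in Ioi 0, f z := by
  rw [lintegral_add_measure, lintegral_dirac]

theorem lintegral_comp_add_Ioi (f : ℝ → ENNReal) (v : ℝ) :
    ∫⁻ z in Ioi 0, f (v + z) = ∫⁻ w in Ioi v, f w := by
  rw [← lintegral_indicator measurableSet_Ioi, ← lintegral_indicator measurableSet_Ioi,
    ← lintegral_add_left_eq_self ((Ioi v).indicator f) v]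
  refine lintegral_congr fun z => ?_
  by_cases hz : 0 < z
  · rw [indicator_of_mem (by simpa using hz), indicator_of_mem (by simpa using hz)]
  · rw [indicator_of_notMem (by simpa using hz), indicator_of_notMem (by simpa using hz)]

theorem measurableSet_lt_prod : MeasurableSet {p : ℝ × ℝ | p.1 < p.2} :=
  measurableSet_lt measurable_fst measurable_snd

theorem lintegral_lintegral_Ioi {μ ν : Measure ℝ} [SFinite μ] [SFinite ν]
    {h : ℝ → ℝ → ENNReal} (hh : Measurable (Function.uncurry h)) :
    ∫⁻ v, ∫⁻ w in Ioi v, h v w ∂ν ∂μ = ∫⁻ w, ∫⁻ v in Iio w, h v w ∂μ ∂ν := by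
  simp_rw [← lintegral_indicator measurableSet_Ioi, ← lintegral_indicator measurableSet_Iio]
  rw [lintegral_lintegral_swap]
  · rfl
  · exact (hh.indicator measurableSet_lt_prod).aemeasurable

section Stieltjes

variable {σ : ℝ → ℝ} (hσ : Monotone σ)

instance : SFinite (sigmaPrime hσ) := by unfold sigmaPrime; infer_instance

/-- The measure comes from the right-continuous modification of `σ`, so equality is claimed only at
continuity points of `σ`; the remaining points are countable. -/
theorem sigmaPrime_Iio_ae (h0 : Tendsto σ atBot (𝓝 0)) :
    ∀ᵐ w, sigmaPrime hσ (Iio w) = ENNReal.ofReal (σ w) := by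
  have hlim : Tendsto hσ.stieltjesFunction atBot (𝓝 0) := by
    have := tendsto_rightLim_atBot_of_tendsto h0
    exact this.congr fun x => (hσ.stieltjesFunction_eq x).symm
  have hc : ∀ᵐ w : ℝ, ContinuousAt σ w := hσ.countable_not_continuousAt.measure_zero volume
  filter_upwards [hc] with w hw
  unfold sigmaPrime
  rw [StieltjesFunction.measure_Iio _ hlim, sub_zero]
  congr 1
  apply le_antisymm
  · refine ((hσ.stieltjesFunction.mono.leftLim_le le_rfl).trans ?_)
    rw [hσ.stieltjesFunction_eq, hw.continuousWithinAt.rightLim_eq]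
  · rw [← hw.continuousWithinAt.leftLim_eq]
    refine le_of_tendsto_of_tendsto (hσ.tendsto_leftLim w)
      (hσ.stieltjesFunction.mono.tendsto_leftLim w) (Eventually.of_forall fun x => ?_)
    rw [hσ.stieltjesFunction_eq]
    exact hσ.le_rightLim le_rfl

/-- Integration by parts in Tonelli form: the `dσ`-mass of `v < w` is `σ(w)`. -/
theorem lintegral_sigmaPrime_tail (h0 : Tendsto σ atBot (𝓝 0)) {h : ℝ → ENNReal}
    (hh : Measurable h) :
    ∫⁻ v, (∫⁻ w in Ioi v, h w) ∂sigmaPrime hσ = ∫⁻ w, ENNReal.ofReal (σ w) * h w := by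
  rw [lintegral_lintegral_Ioi (h := fun _ w => h w) (hh.comp measurable_snd)]
  refine lintegral_congr_ae ?_
  filter_upwards [sigmaPrime_Iio_ae hσ h0] with w hw
  rw [setLIntegral_const, hw, mul_comm]

theorem integral_sigmaPrime_tail (h0 : Tendsto σ atBot (𝓝 0)) (hpos : ∀ x, 0 ≤ σ x)
    {h : ℝ → ℝ} (hh : StronglyMeasurable h) (hi : Integrable fun w => σ w * h w) :
    ∫ v, (∫ w in Ioi v, h w) ∂sigmaPrime hσ = ∫ w, σ w * h w := by
  have hm : StronglyMeasurable
      ({p : ℝ × ℝ | p.1 < p.2}.indicator fun p => h p.2) :=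
    (hh.comp_measurable measurable_snd).indicator measurableSet_lt_prod
  have hind : ∀ v w, ({p : ℝ × ℝ | p.1 < p.2}.indicator (fun p => h p.2)) (v, w)
      = (Iio w).indicator (fun _ => h w) v := fun v w => rfl
  have hreal : ∀ᵐ w, (sigmaPrime hσ).real (Iio w) = σ w := by
    filter_upwards [sigmaPrime_Iio_ae hσ h0] with w hw
    rw [Measure.real, hw, ENNReal.toReal_ofReal (hpos w)]
  have hint : Integrable ({p : ℝ × ℝ | p.1 < p.2}.indicator fun p => h p.2)
      ((sigmaPrime hσ).prod volume) := by
    rw [integrable_prod_iff' hm.aestronglyMeasurable]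
    constructor
    · filter_upwards [sigmaPrime_Iio_ae hσ h0] with w hw
      simp_rw [hind]
      rw [integrable_indicator_iff measurableSet_Iio]
      exact integrableOn_const (by simp [hw])
    · refine hi.norm.congr ?_
      filter_upwards [hreal] with w hw
      simp_rw [hind, norm_indicator_eq_indicator_norm]
      rw [integral_indicator_const _ measurableSet_Iio, hw, smul_eq_mul, norm_mul,
        Real.norm_of_nonneg (hpos w)]
  have hsw := integral_integral_swap (f := fun v w =>
    ({p : ℝ × ℝ | p.1 < p.2}.indicator (fun p => h p.2)) (v, w)) hint
  have h1 : ∀ v, ∫ w in Ioi v, h w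
      = ∫ w, ({p : ℝ × ℝ | p.1 < p.2}.indicator (fun p => h p.2)) (v, w) := fun v => by
    rw [← integral_indicator measurableSet_Ioi]
    rfl
  simp_rw [h1]
  rw [hsw]
  refine integral_congr_ae ?_
  filter_upwards [hreal] with w hw
  simp_rw [hind]
  rw [integral_indicator_const _ measurableSet_Iio, hw, smul_eq_mul]

end Stieltjes

/-! ### Finiteness of the weighted double integrals. -/

namespace IsAirySystem

variable {n : ℕ} {ε s : ℝ} {a : ℕ → ℝ → ℝ} {σ : ℝ → ℝ}

theorem measurable (h : IsAirySystem n ε s a) (p : ℕ) : Measurable (a p) :=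
  (h.continuous p).measurable

theorem lintegral_sq_weight_lt_top (hL2 : ∀ p ≤ 2 * n, Integrable fun r => σ r * a p r ^ 2)
    {p : ℕ} (hp : p ≤ 2 * n) :
    ∫⁻ w, ENNReal.ofReal (σ w) * ENNReal.ofReal (a p w ^ 2) < ⊤ := by
  have h1 : ∀ w, ENNReal.ofReal (σ w) * ENNReal.ofReal (a p w ^ 2)
      = ENNReal.ofReal (σ w * a p w ^ 2) := fun w => (ENNReal.ofReal_mul' (sq_nonneg _)).symm
  simp_rw [h1]
  exact (hL2 p hp).lintegral_lt_top

theorem lintegral_tail_sq_lt_top (h : IsAirySystem n ε s a) (hσ : Monotone σ)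
    (h0 : Tendsto σ atBot (𝓝 0)) (hL2 : ∀ p ≤ 2 * n, Integrable fun r => σ r * a p r ^ 2)
    {p : ℕ} (hp : p ≤ 2 * n) :
    ∫⁻ v, (∫⁻ w in Ioi v, ENNReal.ofReal (a p w ^ 2)) ∂sigmaPrime hσ < ⊤ := by
  have := h.measurable p
  rw [lintegral_sigmaPrime_tail hσ h0 (by fun_prop)]
  exact lintegral_sq_weight_lt_top hL2 hp

/-- A Sobolev bound, from `a_p(v)² = -∫_v^∞ 2 a_p a_{p+1}`. It controls the atom at `0` at the price
of one derivative. -/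
theorem ofReal_sq_le_lintegral (h : IsAirySystem n ε s a) {p : ℕ} (hp : p + 1 ≤ 2 * n) (v : ℝ) :
    ENNReal.ofReal (a p v ^ 2) ≤ (∫⁻ w in Ioi v, ENNReal.ofReal (a p w ^ 2))
      + ∫⁻ w in Ioi v, ENNReal.ofReal (a (p + 1) w ^ 2) := by
  have i0 := h.integrableOn_sq v (i := p) (by omega)
  have i1 := h.integrableOn_sq v (i := p + 1) hp
  have i2 := (h.integrableOn_moment v 0 (i := p) (j := p + 1) (by omega) hp).const_mul 2
  have hdec := h.expDecay p (by omega)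
  have hd : ∀ x, HasDerivAt (fun x => a p x ^ 2) (2 * ((x - v) ^ 0 * (a p x * a (p + 1) x))) x :=
    fun x => ((h.hasDerivAt p x).pow 2).congr_deriv (by simp; ring)
  have key := integral_Ioi_of_hasDerivAt_of_tendsto (a := v)
    (hd v).continuousAt.continuousWithinAt (fun x _ => hd x) i2
    (by simpa [sq] using (hdec.mul hdec).tendsto_zero)
  have hm := h.measurable p
  have hle : a p v ^ 2 ≤ ∫ w in Ioi v, (a p w ^ 2 + a (p + 1) w ^ 2) := by
    have h1 : a p v ^ 2 = ∫ w in Ioi v, -(2 * ((w - v) ^ 0 * (a p w * a (p + 1) w))) := by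
      rw [integral_neg, key]; ring
    rw [h1]
    refine integral_mono i2.neg (i0.fun_add i1) fun w => ?_
    simp only [pow_zero, one_mul]
    nlinarith [sq_nonneg (a p w + a (p + 1) w)]
  refine (ENNReal.ofReal_le_ofReal hle).trans (le_of_eq ?_)
  rw [ofReal_integral_eq_lintegral_ofReal (i0.fun_add i1)
    (Eventually.of_forall fun w => by positivity)]
  simp_rw [ENNReal.ofReal_add (sq_nonneg (a p _)) (sq_nonneg (a (p + 1) _))]
  exact lintegral_add_left (by fun_prop) _

theorem lintegral_sigmaPrime_pointed_sq_lt_top (h : IsAirySystem n ε s a) (hσ : Monotone σ)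
    (h0 : Tendsto σ atBot (𝓝 0)) (hL2 : ∀ p ≤ 2 * n, Integrable fun r => σ r * a p r ^ 2)
    {p : ℕ} (hp : p + 1 ≤ 2 * n) :
    ∫⁻ v, ∫⁻ z, ENNReal.ofReal (a p (v + z) ^ 2) ∂pointedHalfLine ∂sigmaPrime hσ < ⊤ := by
  have h1 := h.lintegral_tail_sq_lt_top hσ h0 hL2 (p := p) (by omega)
  have h2 := h.lintegral_tail_sq_lt_top hσ h0 hL2 hp
  have hle : ∀ v, ∫⁻ z, ENNReal.ofReal (a p (v + z) ^ 2) ∂pointedHalfLine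
      ≤ ((∫⁻ w in Ioi v, ENNReal.ofReal (a p w ^ 2))
        + ∫⁻ w in Ioi v, ENNReal.ofReal (a (p + 1) w ^ 2))
        + ∫⁻ w in Ioi v, ENNReal.ofReal (a p w ^ 2) := fun v => by
    rw [lintegral_pointedHalfLine, add_zero,
      lintegral_comp_add_Ioi (fun w => ENNReal.ofReal (a p w ^ 2)) v]
    gcongr
    exact h.ofReal_sq_le_lintegral hp v
  have hm : ∀ q, Measurable fun v => ∫⁻ w in Ioi v, ENNReal.ofReal (a q w ^ 2) := fun q => by
    have := h.measurable q
    simp_rw [← lintegral_indicator measurableSet_Ioi]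
    have hu : Measurable ({p : ℝ × ℝ | p.1 < p.2}.indicator
        fun p => ENNReal.ofReal (a q p.2 ^ 2)) :=
      Measurable.indicator (by fun_prop) measurableSet_lt_prod
    exact hu.lintegral_prod_right'
  refine (lintegral_mono hle).trans_lt ?_
  rw [lintegral_add_left ((hm p).fun_add (hm (p + 1))), lintegral_add_left (hm p)]
  exact ENNReal.add_lt_top.2 ⟨ENNReal.add_lt_top.2 ⟨h1, h2⟩, h1⟩

theorem lintegral_lintegral_tail_le (h : IsAirySystem n ε s a) (v : ℝ) :
    ∫⁻ w in Ioi v, ∫⁻ x in Ioi w, ENNReal.ofReal ((1 + (x - w)) * a 0 x ^ 2)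
      ≤ ENNReal.ofReal (2 + 64 * n ^ 2)
        * ∑ p ∈ Finset.range (2 * n + 1), ∫⁻ x in Ioi v, ENNReal.ofReal (a p x ^ 2) := by
  have hm := h.measurable 0
  have i0 := (h.integrableOn_sq v (i := 0) (by omega)).const_mul 2
  have i2 := (h.integrableOn_moment v 2 (i := 0) (j := 0) (by omega) (by omega)).const_mul 2
  have h1 : ∫⁻ w in Ioi v, ∫⁻ x in Ioi w, ENNReal.ofReal ((1 + (x - w)) * a 0 x ^ 2)
      ≤ ∫⁻ x in Ioi v, ENNReal.ofReal
        (2 * a 0 x ^ 2 + 2 * ((x - v) ^ 2 * (a 0 x * a 0 x))) := by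
    have hsub : ∀ w ∈ Ioi v, ∫⁻ x in Ioi w, ENNReal.ofReal ((1 + (x - w)) * a 0 x ^ 2)
        = ∫⁻ x in Ioi w, ENNReal.ofReal ((1 + (x - w)) * a 0 x ^ 2) ∂volume.restrict (Ioi v) :=
      fun w hw => by
        rw [Measure.restrict_restrict measurableSet_Ioi,
          inter_eq_left.2 (Ioi_subset_Ioi (le_of_lt hw))]
    -- Exchanging the order leaves `w` in `(v, x)`, an interval of length `x - v`, on which `1 + (x
    -- - w) ≤ 1 + (x - v)`.
    rw [setLIntegral_congr_fun measurableSet_Ioi hsub,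
      lintegral_lintegral_Ioi
        (h := fun w x => ENNReal.ofReal ((1 + (x - w)) * a 0 x ^ 2)) (by
          unfold Function.uncurry
          fun_prop)]
    refine setLIntegral_mono' measurableSet_Ioi fun x hx => ?_
    have hvx : v < x := hx
    rw [Measure.restrict_restrict measurableSet_Iio, inter_comm, Ioi_inter_Iio]
    have h2 : ∫⁻ w in Ioo v x, ENNReal.ofReal ((1 + (x - w)) * a 0 x ^ 2)
        ≤ ∫⁻ w in Ioo v x, ENNReal.ofReal ((1 + (x - v)) * a 0 x ^ 2) :=
      setLIntegral_mono' measurableSet_Ioo fun w hw => by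
        gcongr
        exact hw.1.le
    refine h2.trans ?_
    rw [setLIntegral_const, Real.volume_Ioo, ← ENNReal.ofReal_mul (by
      have := sub_pos.2 hvx
      positivity)]
    apply ENNReal.ofReal_le_ofReal
    have h3 : (1 + (x - v)) * (x - v) ≤ 2 + 2 * (x - v) ^ 2 := by
      nlinarith [sq_nonneg (x - v - 1)]
    nlinarith [mul_le_mul_of_nonneg_right h3 (sq_nonneg (a 0 x))]
  refine h1.trans ?_
  rw [← ofReal_integral_eq_lintegral_ofReal (i0.fun_add i2)
    (Eventually.of_forall fun x => by
      simp only [Pi.zero_apply]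
      nlinarith [sq_nonneg ((x - v) * a 0 x), sq_nonneg (a 0 x)]),
    integral_add i0 i2, integral_const_mul, integral_const_mul]
  have h4 := h.moment_two_zero_zero_le v
  have h5 := integral_sq_le_energy (n := n) (a := a) v (i := 0) (by omega)
  have h6 : ∑ p ∈ Finset.range (2 * n + 1), ∫⁻ x in Ioi v, ENNReal.ofReal (a p x ^ 2)
      = ENNReal.ofReal (energy n a v) := by
    rw [energy, ENNReal.ofReal_sum_of_nonneg fun p _ => integral_nonneg fun _ => sq_nonneg _]
    refine Finset.sum_congr rfl fun p hp => ?_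
    rw [ofReal_integral_eq_lintegral_ofReal
      (h.integrableOn_sq v (by have := Finset.mem_range.1 hp; omega))
      (Eventually.of_forall fun x => sq_nonneg _)]
  rw [h6, ← ENNReal.ofReal_mul (by positivity)]
  apply ENNReal.ofReal_le_ofReal
  unfold moment at h4
  linarith

/-- The tail formula, read backwards, turns `σ(w) dw` into `dσ(v)` and an integral over `w > v`. The
second moment that results is bounded by energies, whose `dσ`-integrals are finite by hypothesis. -/
theorem lintegral_weight_pointed_sq_lt_top (h : IsAirySystem n ε s a) (hσ : Monotone σ)
    (h0 : Tendsto σ atBot (𝓝 0)) (hL2 : ∀ p ≤ 2 * n, Integrable fun r => σ r * a p r ^ 2) :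
    ∫⁻ w, ENNReal.ofReal (σ w)
      * ∫⁻ z, ENNReal.ofReal ((1 + z) * a 0 (w + z) ^ 2) ∂pointedHalfLine < ⊤ := by
  have hm := h.measurable 0
  have hmσ : Measurable σ := hσ.measurable
  have hcomp : ∀ w, ∫⁻ z in Ioi 0, ENNReal.ofReal ((1 + z) * a 0 (w + z) ^ 2)
      = ∫⁻ x in Ioi w, ENNReal.ofReal ((1 + (x - w)) * a 0 x ^ 2) := fun w => by
    rw [← lintegral_comp_add_Ioi (fun x => ENNReal.ofReal ((1 + (x - w)) * a 0 x ^ 2))]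
    simp
  have hmt : Measurable fun w => ∫⁻ z in Ioi 0, ENNReal.ofReal ((1 + z) * a 0 (w + z) ^ 2) :=
    Measurable.lintegral_prod_right'
      (f := fun p : ℝ × ℝ => ENNReal.ofReal ((1 + p.2) * a 0 (p.1 + p.2) ^ 2)) (by fun_prop)
  simp_rw [lintegral_pointedHalfLine, mul_add, add_zero, one_mul]
  rw [lintegral_add_left (by fun_prop)]
  refine ENNReal.add_lt_top.2 ⟨lintegral_sq_weight_lt_top hL2 (by omega), ?_⟩
  rw [← lintegral_sigmaPrime_tail hσ h0 hmt]
  simp_rw [hcomp]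
  refine (lintegral_mono h.lintegral_lintegral_tail_le).trans_lt ?_
  have hm' : ∀ q, Measurable fun v => ∫⁻ w in Ioi v, ENNReal.ofReal (a q w ^ 2) := fun q => by
    have := h.measurable q
    simp_rw [← lintegral_indicator measurableSet_Ioi]
    have hu : Measurable ({p : ℝ × ℝ | p.1 < p.2}.indicator
        fun p => ENNReal.ofReal (a q p.2 ^ 2)) :=
      Measurable.indicator (by fun_prop) measurableSet_lt_prod
    exact hu.lintegral_prod_right'
  rw [lintegral_const_mul' _ _ ENNReal.ofReal_ne_top, lintegral_finsetSum _ fun q _ => hm' q]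
  refine ENNReal.mul_lt_top ENNReal.ofReal_lt_top (ENNReal.sum_lt_top.2 fun q hq => ?_)
  exact h.lintegral_tail_sq_lt_top hσ h0 hL2 (by have := Finset.mem_range.1 hq; omega)

end IsAirySystem

/-! ### The measure `δ₀ + dx` and Fubini for products of transforms. -/

theorem ae_nonneg_pointedHalfLine : ∀ᵐ z ∂pointedHalfLine, 0 ≤ z := by
  rw [ae_add_measure_iff]
  refine ⟨(ae_dirac_iff measurableSet_Ici).2 le_rfl, ?_⟩
  filter_upwards [ae_restrict_mem measurableSet_Ioi] with z hz using le_of_lt hz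

theorem integral_pointedHalfLine {f : ℝ → ℝ} (hf : Integrable f halfLine) :
    ∫ z, f z ∂pointedHalfLine = f 0 + ∫ z, f z ∂halfLine := by
  rw [integral_add_measure (integrable_dirac (by simp)) hf, integral_dirac]

theorem integrable_pointedHalfLine_iff {f : ℝ → ℝ} :
    Integrable f pointedHalfLine ↔ Integrable f halfLine := by
  rw [integrable_add_measure]
  exact ⟨fun h => h.2, fun h => ⟨integrable_dirac (by simp), h⟩⟩

section Pairing

variable {α β : Type*} [MeasurableSpace α] [MeasurableSpace β] {μ : Measure α} {m : Measure β}
  [SFinite m] {a b : α → β → ℝ} {h k : β → ℝ}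

/-- The crossed inequality `|(a h)(b k)| ≤ (a k)² + (h b)²` pairs functions of different variables,
so the inner integrals factor. -/
theorem integrable_mul_mul_mul_prod (ha : Measurable (Function.uncurry a))
    (hb : Measurable (Function.uncurry b)) (hh : Measurable h) (hk : Measurable k)
    (ha2 : ∫⁻ v, ∫⁻ y, ENNReal.ofReal (a v y ^ 2) ∂m ∂μ < ⊤)
    (hb2 : ∫⁻ v, ∫⁻ y, ENNReal.ofReal (b v y ^ 2) ∂m ∂μ < ⊤)
    (hh2 : ∫⁻ y, ENNReal.ofReal (h y ^ 2) ∂m < ⊤)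
    (hk2 : ∫⁻ y, ENNReal.ofReal (k y ^ 2) ∂m < ⊤) :
    Integrable (fun q : α × β × β => (a q.1 q.2.1 * h q.2.1) * (b q.1 q.2.2 * k q.2.2))
      (μ.prod (m.prod m)) := by
  have ma : Measurable fun q : α × β × β => a q.1 q.2.1 :=
    ha.comp (measurable_fst.prodMk measurable_snd.fst)
  have mb : Measurable fun q : α × β × β => b q.1 q.2.2 :=
    hb.comp (measurable_fst.prodMk measurable_snd.snd)
  have ma' : ∀ v, Measurable (a v) := fun v => ha.comp measurable_prodMk_left
  have mb' : ∀ v, Measurable (b v) := fun v => hb.comp measurable_prodMk_left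
  have mA : Measurable fun v => ∫⁻ y, ENNReal.ofReal (a v y ^ 2) ∂m :=
    Measurable.lintegral_prod_right' (f := fun q : α × β => ENNReal.ofReal (a q.1 q.2 ^ 2))
      (ha.pow_const 2).ennreal_ofReal
  refine ⟨by fun_prop, ?_⟩
  have hle : ∀ q : α × β × β, ‖(a q.1 q.2.1 * h q.2.1) * (b q.1 q.2.2 * k q.2.2)‖ₑ
      ≤ ENNReal.ofReal (a q.1 q.2.1 ^ 2) * ENNReal.ofReal (k q.2.2 ^ 2)
        + ENNReal.ofReal (h q.2.1 ^ 2) * ENNReal.ofReal (b q.1 q.2.2 ^ 2) := fun q => by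
    rw [← ENNReal.ofReal_mul (sq_nonneg _), ← ENNReal.ofReal_mul (sq_nonneg _),
      ← ENNReal.ofReal_add (by positivity) (by positivity), Real.enorm_eq_ofReal_abs]
    apply ENNReal.ofReal_le_ofReal
    set A := a q.1 q.2.1
    set B := b q.1 q.2.2
    set H := h q.2.1
    set K := k q.2.2
    rw [abs_le]
    constructor <;> nlinarith [sq_nonneg (A * K + H * B), sq_nonneg (A * K - H * B),
      sq_nonneg (A * K), sq_nonneg (H * B)]
  refine (lintegral_mono hle).trans_lt ?_
  rw [lintegral_prod _ (by fun_prop)]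
  have hin : ∀ v, ∫⁻ q : β × β, (ENNReal.ofReal (a v q.1 ^ 2) * ENNReal.ofReal (k q.2 ^ 2)
        + ENNReal.ofReal (h q.1 ^ 2) * ENNReal.ofReal (b v q.2 ^ 2)) ∂m.prod m
      = (∫⁻ y, ENNReal.ofReal (a v y ^ 2) ∂m) * (∫⁻ y, ENNReal.ofReal (k y ^ 2) ∂m)
        + (∫⁻ y, ENNReal.ofReal (h y ^ 2) ∂m) * ∫⁻ y, ENNReal.ofReal (b v y ^ 2) ∂m :=
    fun v => by
      have := ma' v
      have := mb' v
      rw [lintegral_add_left (by fun_prop),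
        lintegral_prod_mul (f := fun y => ENNReal.ofReal (a v y ^ 2))
          (g := fun y => ENNReal.ofReal (k y ^ 2)) (by fun_prop) (by fun_prop),
        lintegral_prod_mul (f := fun y => ENNReal.ofReal (h y ^ 2))
          (g := fun y => ENNReal.ofReal (b v y ^ 2)) (by fun_prop) (by fun_prop)]
  simp_rw [hin]
  rw [lintegral_add_left (mA.mul_const _), lintegral_mul_const _ mA,
    lintegral_const_mul' _ _ hh2.ne]
  exact ENNReal.add_lt_top.2 ⟨ENNReal.mul_lt_top ha2 hk2, ENNReal.mul_lt_top hh2 hb2⟩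

theorem integrable_integral_mul_integral [SFinite μ] (ha : Measurable (Function.uncurry a))
    (hb : Measurable (Function.uncurry b)) (hh : Measurable h) (hk : Measurable k)
    (ha2 : ∫⁻ v, ∫⁻ y, ENNReal.ofReal (a v y ^ 2) ∂m ∂μ < ⊤)
    (hb2 : ∫⁻ v, ∫⁻ y, ENNReal.ofReal (b v y ^ 2) ∂m ∂μ < ⊤)
    (hh2 : ∫⁻ y, ENNReal.ofReal (h y ^ 2) ∂m < ⊤)
    (hk2 : ∫⁻ y, ENNReal.ofReal (k y ^ 2) ∂m < ⊤) :
    Integrable (fun v => (∫ y, a v y * h y ∂m) * ∫ z, b v z * k z ∂m) μ := by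
  have := (integrable_mul_mul_mul_prod ha hb hh hk ha2 hb2 hh2 hk2).integral_prod_left
  exact this.congr (Eventually.of_forall fun v =>
    integral_prod_mul (fun y => a v y * h y) fun z => b v z * k z)

theorem integral_integral_mul_integral [SFinite μ] (ha : Measurable (Function.uncurry a))
    (hb : Measurable (Function.uncurry b)) (hh : Measurable h) (hk : Measurable k)
    (ha2 : ∫⁻ v, ∫⁻ y, ENNReal.ofReal (a v y ^ 2) ∂m ∂μ < ⊤)
    (hb2 : ∫⁻ v, ∫⁻ y, ENNReal.ofReal (b v y ^ 2) ∂m ∂μ < ⊤)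
    (hh2 : ∫⁻ y, ENNReal.ofReal (h y ^ 2) ∂m < ⊤)
    (hk2 : ∫⁻ y, ENNReal.ofReal (k y ^ 2) ∂m < ⊤) :
    ∫ v, (∫ y, a v y * h y ∂m) * (∫ z, b v z * k z ∂m) ∂μ
      = ∫ y, h y * ∫ z, (∫ v, a v y * b v z ∂μ) * k z ∂m ∂m := by
  have hi := integrable_mul_mul_mul_prod ha hb hh hk ha2 hb2 hh2 hk2
  have h1 : ∀ v, (∫ y, a v y * h y ∂m) * (∫ z, b v z * k z ∂m)
      = ∫ q : β × β, (a v q.1 * h q.1) * (b v q.2 * k q.2) ∂m.prod m := fun v =>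
    (integral_prod_mul (fun y => a v y * h y) fun z => b v z * k z).symm
  simp_rw [h1]
  rw [← integral_prod _ hi, integral_prod_symm _ hi, integral_prod _ hi.integral_prod_right]
  refine integral_congr_ae (Eventually.of_forall fun y => ?_)
  simp only
  rw [← integral_const_mul]
  refine integral_congr_ae (Eventually.of_forall fun z => ?_)
  simp only
  rw [← integral_mul_const, ← integral_const_mul]
  refine integral_congr_ae (Eventually.of_forall fun v => ?_)
  simp only
  ring

end Pairing

/-! ### Bounded integral operators on the half-line. -/

theorem abs_integral_mul_le_sqrt_mul_sqrt {α : Type*} [MeasurableSpace α] {μ : Measure α}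
    {f g : α → ℝ} (hf : MemLp f 2 μ) (hg : MemLp g 2 μ) :
    |∫ x, f x * g x ∂μ| ≤ √(∫ x, f x ^ 2 ∂μ) * √(∫ x, g x ^ 2 ∂μ) := by
  have hinner : ∀ {u w : α → ℝ} (hu : MemLp u 2 μ) (hw : MemLp w 2 μ),
      inner ℝ (hu.toLp u) (hw.toLp w) = ∫ x, u x * w x ∂μ := fun hu hw => by
    rw [L2.inner_def]
    refine integral_congr_ae ?_
    filter_upwards [hu.coeFn_toLp, hw.coeFn_toLp] with x h1 h2
    simp [h1, h2, mul_comm]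
  have hnorm : ∀ {u : α → ℝ} (hu : MemLp u 2 μ), ‖hu.toLp u‖ = √(∫ x, u x ^ 2 ∂μ) := fun hu => by
    rw [norm_eq_sqrt_real_inner, hinner hu hu]
    simp only [sq]
  rw [← hinner hf hg, ← hnorm hf, ← hnorm hg]
  exact abs_real_inner_le_norm _ _

/-- A kernel dominated by a square-integrable rank-one kernel is a bounded integral operator. -/
theorem exists_isIntegralOperator {k : ℝ → ℝ → ℝ} {G : ℝ → ℝ}
    (hk : Measurable (Function.uncurry k)) (hG : MemLp G 2 halfLine) (hG0 : ∀ x, 0 ≤ G x)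
    (hle : ∀ x y, 0 < x → 0 < y → |k x y| ≤ G x * G y) :
    ∃ T, IsIntegralOperator k T := by
  have hpos : ∀ᵐ x ∂halfLine, 0 < x := ae_restrict_mem measurableSet_Ioi
  have hint : ∀ (f : HalfLineL2) (x : ℝ), 0 < x → Integrable (fun y => k x y * f y) halfLine := by
    intro f x hx
    have h1 : Integrable (fun y => G x * ‖G y * f y‖) halfLine :=
      (hG.integrable_mul (Lp.memLp f)).norm.const_mul _
    refine h1.mono' ?_ ?_
    · exact (hk.comp measurable_prodMk_left).aestronglyMeasurable.mul
        (Lp.aestronglyMeasurable f)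
    · filter_upwards [hpos] with y hy
      rw [norm_mul, norm_mul, Real.norm_of_nonneg (hG0 y), ← mul_assoc]
      exact mul_le_mul_of_nonneg_right (hle x y hx hy) (norm_nonneg _)
  have hbound : ∀ (f : HalfLineL2) (x : ℝ), 0 < x →
      |∫ y, k x y * f y ∂halfLine| ≤ (√(∫ y, G y ^ 2 ∂halfLine) * ‖f‖) * G x := by
    intro f x hx
    have h1 : ‖∫ y, k x y * f y ∂halfLine‖ ≤ ∫ y, G x * (G y * ‖f y‖) ∂halfLine := by
      refine norm_integral_le_of_norm_le
        ((hG.integrable_mul (Lp.memLp f).norm).const_mul _) ?_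
      filter_upwards [hpos] with y hy
      rw [norm_mul, ← mul_assoc]
      exact mul_le_mul_of_nonneg_right (hle x y hx hy) (norm_nonneg _)
    rw [integral_const_mul] at h1
    have h2 := (le_abs_self _).trans (abs_integral_mul_le_sqrt_mul_sqrt hG (Lp.memLp f).norm)
    have h3 : √(∫ y, ‖f y‖ ^ 2 ∂halfLine) = ‖f‖ := by
      rw [norm_eq_sqrt_real_inner, L2.inner_def]
      simp
    rw [h3] at h2
    rw [mul_comm _ (G x)]
    exact h1.trans (mul_le_mul_of_nonneg_left h2 (hG0 x))
  have hmem : ∀ f : HalfLineL2, MemLp (fun x => ∫ y, k x y * f y ∂halfLine) 2 halfLine := by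
    intro f
    refine (hG.const_mul (√(∫ y, G y ^ 2 ∂halfLine) * ‖f‖)).of_le ?_ ?_
    · have hm : StronglyMeasurable (Function.uncurry fun x y => k x y * f y) :=
        (hk.mul ((Lp.stronglyMeasurable f).measurable.comp measurable_snd)).stronglyMeasurable
      exact hm.integral_prod_right.aestronglyMeasurable
    · filter_upwards [hpos] with x hx
      refine (hbound f x hx).trans (le_abs_self _)
  let L : HalfLineL2 →ₗ[ℝ] HalfLineL2 :=
    { toFun := fun f => (hmem f).toLp _
      map_add' := fun f g => by
        apply Lp.ext
        filter_upwards [(hmem (f + g)).coeFn_toLp, (hmem f).coeFn_toLp, (hmem g).coeFn_toLp,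
          Lp.coeFn_add ((hmem f).toLp _) ((hmem g).toLp _), hpos] with x h1 h2 h3 h4 hx
        rw [h1, h4, Pi.add_apply, h2, h3, ← integral_add (hint f x hx) (hint g x hx)]
        refine integral_congr_ae ?_
        filter_upwards [Lp.coeFn_add f g] with y hy
        rw [hy, Pi.add_apply, mul_add]
      map_smul' := fun c f => by
        apply Lp.ext
        filter_upwards [(hmem (c • f)).coeFn_toLp, (hmem f).coeFn_toLp,
          Lp.coeFn_smul c ((hmem f).toLp _)] with x h1 h2 h3
        rw [h1, RingHom.id_apply, h3, Pi.smul_apply, h2, smul_eq_mul, ← integral_const_mul]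
        refine integral_congr_ae ?_
        filter_upwards [Lp.coeFn_smul c f] with y hy
        rw [hy, Pi.smul_apply, smul_eq_mul]
        ring }
  have hL : ∀ f, ‖L f‖ ≤ (√(∫ y, G y ^ 2 ∂halfLine) * ‖hG.toLp G‖) * ‖f‖ := by
    intro f
    have h1 : ‖L f‖ ≤ ‖(√(∫ y, G y ^ 2 ∂halfLine) * ‖f‖) • hG.toLp G‖ := by
      apply Lp.norm_le_norm_of_ae_le
      filter_upwards [(hmem f).coeFn_toLp, Lp.coeFn_smul (√(∫ y, G y ^ 2 ∂halfLine) * ‖f‖)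
        (hG.toLp G), hG.coeFn_toLp, hpos] with x h1 h2 h3 hx
      change ‖(hmem f).toLp _ x‖ ≤ _
      rw [h1, h2, Pi.smul_apply, h3, smul_eq_mul]
      exact (hbound f x hx).trans (le_abs_self _)
    rw [norm_smul, Real.norm_of_nonneg (by positivity)] at h1
    linarith
  refine ⟨L.mkContinuous _ hL, fun f => ?_⟩
  filter_upwards [(hmem f).coeFn_toLp, hpos] with x h1 hx
  exact ⟨hint f x hx, h1⟩

/-! ### Weighted spaces and the Airy transform. -/

/-- `h` is square integrable against `(1 + y) (δ₀ + dy)`. -/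
structure IsWeightedL2 (h : ℝ → ℝ) : Prop where
  measurable : Measurable h
  integrable : Integrable (fun y => (1 + |y|) * h y ^ 2) pointedHalfLine

/-- `g` is square integrable against `(1 + y)⁻¹ (δ₀ + dy)`. -/
structure IsCoweightedL2 (g : ℝ → ℝ) : Prop where
  measurable : Measurable g
  integrable : Integrable (fun y => g y ^ 2 / (1 + |y|)) pointedHalfLine

theorem one_add_abs_pos (y : ℝ) : 0 < 1 + |y| := by positivity

theorem IsWeightedL2.coweighted {h : ℝ → ℝ} (hh : IsWeightedL2 h) : IsCoweightedL2 h := by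
  have hm := hh.measurable
  refine ⟨hm, hh.integrable.mono' (Measurable.aestronglyMeasurable (by fun_prop))
    (Eventually.of_forall fun y => ?_)⟩
  have h1 := one_add_abs_pos y
  rw [Real.norm_of_nonneg (by positivity), div_le_iff₀ h1]
  nlinarith [abs_nonneg y, mul_nonneg (abs_nonneg y) (sq_nonneg (h y)),
    mul_nonneg (mul_nonneg (abs_nonneg y) (abs_nonneg y)) (sq_nonneg (h y))]

/-- The reason for the two weights: multiplication by `y` maps one space to the other, since `y² /
(1 + y) ≤ 1 + y` for `y ≥ 0`. -/
theorem IsWeightedL2.coweighted_id_mul {h : ℝ → ℝ} (hh : IsWeightedL2 h) :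
    IsCoweightedL2 fun y => y * h y := by
  have hm := hh.measurable
  refine ⟨by fun_prop, hh.integrable.mono' (Measurable.aestronglyMeasurable (by fun_prop))
    (Eventually.of_forall fun y => ?_)⟩
  have h1 := one_add_abs_pos y
  rw [Real.norm_of_nonneg (by positivity), div_le_iff₀ h1, mul_pow, ← sq_abs y]
  nlinarith [abs_nonneg y, mul_nonneg (abs_nonneg y) (sq_nonneg (h y)), sq_nonneg (h y)]

theorem IsWeightedL2.integrable_sq {h : ℝ → ℝ} (hh : IsWeightedL2 h) :
    Integrable (fun y => h y ^ 2) pointedHalfLine := by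
  have hm := hh.measurable
  refine hh.integrable.mono' (by fun_prop) (Eventually.of_forall fun y => ?_)
  rw [Real.norm_of_nonneg (by positivity)]
  nlinarith [mul_nonneg (abs_nonneg y) (sq_nonneg (h y))]

theorem IsWeightedL2.integrable_id_mul_mul {h k : ℝ → ℝ} (hh : IsWeightedL2 h)
    (hk : IsWeightedL2 k) : Integrable (fun y => y * h y * k y) pointedHalfLine := by
  have hm := hh.measurable
  have km := hk.measurable
  refine (hh.integrable.fun_add hk.integrable).mono' (by fun_prop)
    (Eventually.of_forall fun y => ?_)
  rw [norm_mul, norm_mul, Real.norm_eq_abs, Real.norm_eq_abs, Real.norm_eq_abs, ← sq_abs (h y),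
    ← sq_abs (k y)]
  have h1 : |h y| * |k y| ≤ |h y| ^ 2 + |k y| ^ 2 := by
    nlinarith [sq_nonneg (|h y| - |k y|), sq_nonneg (|h y|), sq_nonneg (|k y|)]
  nlinarith [mul_le_mul_of_nonneg_left h1 (abs_nonneg y), sq_nonneg (|h y|), sq_nonneg (|k y|)]

theorem IsCoweightedL2.integrable_exp_mul {g : ℝ → ℝ} (hg : IsCoweightedL2 g) {c : ℝ}
    (hc : 0 < c) : Integrable (fun z => Real.exp (-c * z) * g z) pointedHalfLine := by
  have hm := hg.measurable
  have h0 : ExpDecay fun z => Real.exp (-(2 * c) * z) :=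
    ⟨2 * c, by linarith, Asymptotics.isBigO_refl _ _⟩
  have h1 : Integrable (fun z => (z - (-1)) * Real.exp (-(2 * c) * z)) pointedHalfLine :=
    integrable_pointedHalfLine_iff.2
      ((h0.sub_const_mul (-1)).integrableOn_Ioi (by fun_prop) 0)
  refine (h1.fun_add hg.integrable).mono' (by fun_prop) ?_
  filter_upwards [ae_nonneg_pointedHalfLine] with z hz
  have h2 : Real.exp (-(2 * c) * z) = Real.exp (-c * z) ^ 2 := by
    rw [sq, ← Real.exp_add]; congr 1; ring
  rw [abs_of_nonneg hz, sub_neg_eq_add, h2, norm_mul, Real.norm_eq_abs, Real.abs_exp,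
    Real.norm_eq_abs, ← sq_abs (g z)]
  have h3 : 0 < 1 + z := by linarith
  set E := Real.exp (-c * z)
  have h4 : (z + 1) * E ^ 2 + |g z| ^ 2 / (1 + z) - E * |g z|
      = (((1 + z) * E - |g z| / 2) ^ 2 + 3 / 4 * |g z| ^ 2) / (1 + z) := by
    field_simp
    ring
  have h5 : 0 ≤ (((1 + z) * E - |g z| / 2) ^ 2 + 3 / 4 * |g z| ^ 2) / (1 + z) := by positivity
  linarith

/-- The function `v ↦ ∫ a_p(v + z) g(z) (δ₀ + dz)`. -/
noncomputable def airyTransform (a : ℕ → ℝ → ℝ) (p : ℕ) (g : ℝ → ℝ) (v : ℝ) : ℝ :=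
  ∫ z, a p (v + z) * g z ∂pointedHalfLine

namespace IsAirySystem

variable {n : ℕ} {ε s : ℝ} {a : ℕ → ℝ → ℝ} {g h k : ℝ → ℝ} {p q : ℕ}

theorem exists_abs_le (ha : IsAirySystem n ε s a) (hp : p ≤ 2 * n) (v₀ : ℝ) :
    ∃ C c : ℝ, 0 < c ∧ 0 ≤ C ∧ ∀ v z, v₀ ≤ v → 0 ≤ z →
      |a p (v + z)| ≤ C * Real.exp (-c * v) * Real.exp (-c * z) := by
  obtain ⟨C, c, hc, hC, hle⟩ := (ha.expDecay p hp).exists_bound (ha.continuous p) v₀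
  refine ⟨C, c, hc, hC, fun v z hv hz => (hle (v + z) (by linarith)).trans (le_of_eq ?_)⟩
  rw [mul_assoc, ← Real.exp_add, mul_add]

theorem measurable_comp_add (ha : IsAirySystem n ε s a) (p : ℕ) :
    Measurable fun x : ℝ × ℝ => a p (x.1 + x.2) :=
  (ha.measurable p).comp (by fun_prop)

theorem integrable_airyTransform (ha : IsAirySystem n ε s a) (hp : p ≤ 2 * n)
    (hg : IsCoweightedL2 g) (v : ℝ) :
    Integrable (fun z => a p (v + z) * g z) pointedHalfLine := by
  obtain ⟨C, c, hc, hC, hle⟩ := ha.exists_abs_le hp v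
  have hm := hg.measurable
  have ham := ha.measurable p
  refine ((hg.integrable_exp_mul hc).norm.const_mul (C * Real.exp (-c * v))).mono'
    (by fun_prop) ?_
  filter_upwards [ae_nonneg_pointedHalfLine] with z hz
  rw [norm_mul, norm_mul, ← mul_assoc, Real.norm_eq_abs (Real.exp _), Real.abs_exp]
  exact mul_le_mul_of_nonneg_right (hle v z le_rfl hz) (norm_nonneg _)

theorem measurable_airyTransform (ha : IsAirySystem n ε s a) (p : ℕ) (hg : Measurable g) :
    StronglyMeasurable (airyTransform a p g) := by
  have h1 : StronglyMeasurable (Function.uncurry fun v z => a p (v + z) * g z) :=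
    ((ha.measurable_comp_add p).mul (hg.comp measurable_snd)).stronglyMeasurable
  exact h1.integral_prod_right

theorem expDecay_airyTransform (ha : IsAirySystem n ε s a) (hp : p ≤ 2 * n)
    (hg : IsCoweightedL2 g) : ExpDecay (airyTransform a p g) := by
  obtain ⟨C, c, hc, hC, hle⟩ := ha.exists_abs_le hp 0
  refine ⟨c, hc, Asymptotics.IsBigO.of_bound
    (C * ∫ z, ‖Real.exp (-c * z) * g z‖ ∂pointedHalfLine) ?_⟩
  filter_upwards [eventually_ge_atTop 0] with v hv
  have h1 : ‖airyTransform a p g v‖ ≤ ∫ z, C * Real.exp (-c * v) *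
      ‖Real.exp (-c * z) * g z‖ ∂pointedHalfLine := by
    refine norm_integral_le_of_norm_le ((hg.integrable_exp_mul hc).norm.const_mul _) ?_
    filter_upwards [ae_nonneg_pointedHalfLine] with z hz
    rw [norm_mul, norm_mul, ← mul_assoc, Real.norm_eq_abs (Real.exp _), Real.abs_exp]
    exact mul_le_mul_of_nonneg_right (hle v z hv hz) (norm_nonneg _)
  rw [integral_const_mul] at h1
  rw [Real.norm_eq_abs (Real.exp _), Real.abs_exp]
  linarith

theorem hasDerivAt_airyTransform (ha : IsAirySystem n ε s a) (hp : p + 1 ≤ 2 * n)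
    (hg : IsCoweightedL2 g) (v : ℝ) :
    HasDerivAt (airyTransform a p g) (airyTransform a (p + 1) g v) v := by
  -- The base point `v - 1` makes the bound uniform near `v`.
  obtain ⟨C, c, hc, hC, hle⟩ := ha.exists_abs_le hp (v - 1)
  have hm := hg.measurable
  have ham := ha.measurable p
  have ham' := ha.measurable (p + 1)
  refine (hasDerivAt_integral_of_dominated_loc_of_deriv_le (μ := pointedHalfLine)
    (F := fun v z => a p (v + z) * g z) (F' := fun v z => a (p + 1) (v + z) * g z)
    (bound := fun z => C * Real.exp (-c * (v - 1)) * ‖Real.exp (-c * z) * g z‖)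
    (s := Ioi (v - 1)) (Ioi_mem_nhds (by linarith))
    (Eventually.of_forall fun w => by fun_prop) (ha.integrable_airyTransform (by omega) hg v)
    (by fun_prop) ?_ ((hg.integrable_exp_mul hc).norm.const_mul _) ?_).2
  · filter_upwards [ae_nonneg_pointedHalfLine] with z hz w hw
    have hw' : v - 1 ≤ w := le_of_lt hw
    rw [norm_mul, norm_mul, ← mul_assoc, Real.norm_eq_abs (Real.exp _), Real.abs_exp]
    refine mul_le_mul_of_nonneg_right ((hle w z hw' hz).trans ?_) (norm_nonneg _)
    gcongr ?_ * _
    gcongr C * ?_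
    exact Real.exp_le_exp.2 (by nlinarith)
  · exact Eventually.of_forall fun z w _ =>
      ((ha.hasDerivAt p (w + z)).comp_add_const w z).mul_const (g z)

theorem airyTransform_ode (ha : IsAirySystem n ε s a) (hh : IsWeightedL2 h) (v : ℝ) :
    airyTransform a (2 * n) h v
      = ε * ((v + s) * airyTransform a 0 h v + airyTransform a 0 (fun y => y * h y) v) := by
  have h0 := ha.integrable_airyTransform (p := 0) (by omega) hh.coweighted v
  have h1 := ha.integrable_airyTransform (p := 0) (by omega) hh.coweighted_id_mul v
  unfold airyTransform
  rw [← integral_const_mul, ← integral_add (h0.const_mul _) h1, ← integral_const_mul]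
  refine integral_congr_ae (Eventually.of_forall fun z => ?_)
  simp only [ha.ode]
  ring

end IsAirySystem

/-! ### The pairing with weight `σ`. -/

/-- An Airy system together with a distribution function `σ` making its components square
integrable. -/
structure IsWeightedAirySystem (n : ℕ) (ε s : ℝ) (a : ℕ → ℝ → ℝ) (σ : ℝ → ℝ) : Prop
    extends IsAirySystem n ε s a where
  monotone : Monotone σ
  tendsto_atBot : Tendsto σ atBot (𝓝 0)
  integrable_sq : ∀ p ≤ 2 * n, Integrable fun r => σ r * a p r ^ 2

/-- `∫ σ(v) a₀(v + y) a₀(v + z) dv`. -/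
noncomputable def airyKernel (a : ℕ → ℝ → ℝ) (σ : ℝ → ℝ) (y z : ℝ) : ℝ :=
  ∫ v, σ v * a 0 (v + y) * a 0 (v + z)

namespace IsWeightedAirySystem

variable {n : ℕ} {ε s : ℝ} {a : ℕ → ℝ → ℝ} {σ g h k : ℝ → ℝ} {p q : ℕ}

theorem nonneg (ha : IsWeightedAirySystem n ε s a σ) (x : ℝ) : 0 ≤ σ x :=
  le_of_tendsto ha.tendsto_atBot
    ((eventually_le_atBot x).mono fun _ hy => ha.monotone hy)

theorem integrable_sigmaPrime (ha : IsWeightedAirySystem n ε s a σ) (hp : p + 1 ≤ 2 * n)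
    (hq : q + 1 ≤ 2 * n) (hh : IsWeightedL2 h) (hk : IsWeightedL2 k) :
    Integrable (fun v => airyTransform a p h v * airyTransform a q k v)
      (sigmaPrime ha.monotone) :=
  integrable_integral_mul_integral (m := pointedHalfLine)
    (a := fun v z => a p (v + z)) (b := fun v z => a q (v + z))
    (ha.measurable_comp_add p) (ha.measurable_comp_add q) hh.measurable hk.measurable
    (ha.lintegral_sigmaPrime_pointed_sq_lt_top ha.monotone ha.tendsto_atBot ha.integrable_sq hp)
    (ha.lintegral_sigmaPrime_pointed_sq_lt_top ha.monotone ha.tendsto_atBot ha.integrable_sq hq)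
    hh.integrable_sq.lintegral_lt_top hk.integrable_sq.lintegral_lt_top

theorem lintegral_weight_lt_top (ha : IsWeightedAirySystem n ε s a σ) :
    ∫⁻ v, ∫⁻ z, ENNReal.ofReal ((√(σ v) * √(1 + |z|) * a 0 (v + z)) ^ 2) ∂pointedHalfLine
      < ⊤ := by
  have ham := ha.measurable 0
  refine lt_of_le_of_lt (lintegral_mono fun v => ?_)
    (ha.lintegral_weight_pointed_sq_lt_top ha.monotone ha.tendsto_atBot ha.integrable_sq)
  rw [← lintegral_const_mul' _ _ ENNReal.ofReal_ne_top]
  refine lintegral_mono_ae ?_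
  filter_upwards [ae_nonneg_pointedHalfLine] with z hz
  rw [← ENNReal.ofReal_mul (ha.nonneg v), mul_pow, mul_pow, Real.sq_sqrt (ha.nonneg v),
    Real.sq_sqrt (one_add_abs_pos z).le, abs_of_nonneg hz, mul_assoc]

theorem pairing (ha : IsWeightedAirySystem n ε s a σ) (hh : IsCoweightedL2 h)
    (hk : IsCoweightedL2 k) :
    Integrable (fun v => σ v * (airyTransform a 0 h v * airyTransform a 0 k v)) ∧
    ∫ v, σ v * (airyTransform a 0 h v * airyTransform a 0 k v)
      = ∫ y, h y * ∫ z, airyKernel a σ y z * k z ∂pointedHalfLine ∂pointedHalfLine := by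
  have ham := ha.measurable 0
  have hσm := ha.monotone.measurable
  have hmeas : Measurable (Function.uncurry fun v z : ℝ => √(σ v) * √(1 + |z|) * a 0 (v + z)) := by
    unfold Function.uncurry
    fun_prop
  have hm : ∀ {g : ℝ → ℝ}, IsCoweightedL2 g → Measurable fun y => g y / √(1 + |y|) :=
    fun hg => by
      have := hg.measurable
      fun_prop
  have hfin : ∀ {g : ℝ → ℝ}, IsCoweightedL2 g →
      ∫⁻ y, ENNReal.ofReal ((g y / √(1 + |y|)) ^ 2) ∂pointedHalfLine < ⊤ := fun hg => by
    simp_rw [div_pow, Real.sq_sqrt (one_add_abs_pos _).le]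
    exact hg.integrable.lintegral_lt_top
  have hw := ha.lintegral_weight_lt_top
  have hT : ∀ (g : ℝ → ℝ) (v : ℝ), ∫ y, √(σ v) * √(1 + |y|) * a 0 (v + y) * (g y / √(1 + |y|))
      ∂pointedHalfLine = √(σ v) * airyTransform a 0 g v := fun g v => by
    rw [airyTransform, ← integral_const_mul]
    refine integral_congr_ae (Eventually.of_forall fun y => ?_)
    have := Real.sqrt_pos.2 (one_add_abs_pos y)
    field_simp
  have hprod : ∀ v, √(σ v) * airyTransform a 0 h v * (√(σ v) * airyTransform a 0 k v)
      = σ v * (airyTransform a 0 h v * airyTransform a 0 k v) := fun v => by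
    linear_combination (airyTransform a 0 h v * airyTransform a 0 k v)
      * Real.mul_self_sqrt (ha.nonneg v)
  have h1 := integrable_integral_mul_integral hmeas hmeas (hm hh) (hm hk) hw hw (hfin hh) (hfin hk)
  have h2 := integral_integral_mul_integral hmeas hmeas (hm hh) (hm hk) hw hw (hfin hh) (hfin hk)
  simp_rw [hT, hprod] at h1 h2
  refine ⟨h1, h2.trans ?_⟩
  refine integral_congr_ae (Eventually.of_forall fun y => ?_)
  have hy := Real.sqrt_pos.2 (one_add_abs_pos y)
  simp only
  rw [← integral_const_mul, ← integral_const_mul]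
  refine integral_congr_ae (Eventually.of_forall fun z => ?_)
  have hz := Real.sqrt_pos.2 (one_add_abs_pos z)
  have h3 : ∫ v, √(σ v) * √(1 + |y|) * a 0 (v + y) * (√(σ v) * √(1 + |z|) * a 0 (v + z))
      = √(1 + |y|) * √(1 + |z|) * airyKernel a σ y z := by
    rw [airyKernel, ← integral_const_mul]
    refine integral_congr_ae (Eventually.of_forall fun v => ?_)
    simp only
    linear_combination (√(1 + |y|) * √(1 + |z|) * a 0 (v + y) * a 0 (v + z))
      * Real.mul_self_sqrt (ha.nonneg v)
  simp only [h3]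
  field_simp

end IsWeightedAirySystem

/-! ### The bilinear concomitant. -/

namespace IsWeightedAirySystem

variable {n : ℕ} {ε s : ℝ} {a : ℕ → ℝ → ℝ} {σ f r : ℝ → ℝ}

/-- The bilinear concomitant of the transforms of `f` and `r`. -/
noncomputable def concomitant (n : ℕ) (a : ℕ → ℝ → ℝ) (f r : ℝ → ℝ) (v : ℝ) : ℝ :=
  ∑ l ∈ Finset.range n,
    (airyTransform a (2 * n - 1 - 2 * l) f v * airyTransform a (2 * l) r v
      - airyTransform a (2 * n - 2 - 2 * l) f v * airyTransform a (2 * l + 1) r v)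

theorem hasDerivAt_concomitant (ha : IsWeightedAirySystem n ε s a σ) (hf : IsCoweightedL2 f)
    (hr : IsCoweightedL2 r) (v : ℝ) :
    HasDerivAt (concomitant n a f r)
      (airyTransform a (2 * n) f v * airyTransform a 0 r v
        - airyTransform a 0 f v * airyTransform a (2 * n) r v) v := by
  have hsum : HasDerivAt (concomitant n a f r) (∑ l ∈ Finset.range n,
      (airyTransform a (2 * n - 2 * l) f v * airyTransform a (2 * l) r v
        - airyTransform a (2 * n - 2 * (l + 1)) f v * airyTransform a (2 * (l + 1)) r v)) v := by
    refine HasDerivAt.fun_sum fun l hl => ?_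
    have hl := Finset.mem_range.1 hl
    have h1 := ha.hasDerivAt_airyTransform (p := 2 * n - 1 - 2 * l) (by omega) hf v
    have h2 := ha.hasDerivAt_airyTransform (p := 2 * l) (by omega) hr v
    have h3 := ha.hasDerivAt_airyTransform (p := 2 * n - 2 - 2 * l) (by omega) hf v
    have h4 := ha.hasDerivAt_airyTransform (p := 2 * l + 1) (by omega) hr v
    rw [show 2 * n - 1 - 2 * l + 1 = 2 * n - 2 * l by omega] at h1
    rw [show 2 * n - 2 - 2 * l + 1 = 2 * n - 1 - 2 * l by omega] at h3
    refine ((h1.mul h2).sub (h3.mul h4)).congr_deriv ?_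
    rw [show 2 * n - 2 * (l + 1) = 2 * n - 2 - 2 * l by omega,
      show 2 * (l + 1) = 2 * l + 1 + 1 by ring]
    ring
  rw [Finset.sum_range_sub'
    (fun l => airyTransform a (2 * n - 2 * l) f v * airyTransform a (2 * l) r v)] at hsum
  simpa using hsum

theorem tendsto_concomitant (ha : IsWeightedAirySystem n ε s a σ) (hf : IsCoweightedL2 f)
    (hr : IsCoweightedL2 r) : Tendsto (concomitant n a f r) atTop (𝓝 0) := by
  unfold concomitant
  rw [← Finset.sum_const_zero (s := Finset.range n)]
  refine tendsto_finsetSum _ fun l hl => ?_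
  have hl := Finset.mem_range.1 hl
  have h : ∀ {p q : ℕ}, p ≤ 2 * n → q ≤ 2 * n → Tendsto
      (fun v => airyTransform a p f v * airyTransform a q r v) atTop (𝓝 0) := fun hp hq =>
    ((ha.expDecay_airyTransform hp hf).mul (ha.expDecay_airyTransform hq hr)).tendsto_zero
  simpa using (h (p := 2 * n - 1 - 2 * l) (q := 2 * l) (by omega) (by omega)).sub
    (h (p := 2 * n - 2 - 2 * l) (q := 2 * l + 1) (by omega) (by omega))

theorem integral_concomitant (ha : IsWeightedAirySystem n ε s a σ) (hf : IsWeightedL2 f)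
    (hr : IsWeightedL2 r) :
    ∫ v, concomitant n a f r v ∂sigmaPrime ha.monotone
      = ∑ l ∈ Finset.range n,
        ((∫ v, airyTransform a (2 * n - 1 - 2 * l) f v * airyTransform a (2 * l) r v
            ∂sigmaPrime ha.monotone)
          - ∫ v, airyTransform a (2 * n - 2 - 2 * l) f v * airyTransform a (2 * l + 1) r v
            ∂sigmaPrime ha.monotone) := by
  unfold concomitant
  have h1 : ∀ l ∈ Finset.range n, Integrable (fun v =>
      airyTransform a (2 * n - 1 - 2 * l) f v * airyTransform a (2 * l) r v)
      (sigmaPrime ha.monotone) := fun l hl => by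
    have hl := Finset.mem_range.1 hl
    exact ha.integrable_sigmaPrime (by omega) (by omega) hf hr
  have h2 : ∀ l ∈ Finset.range n, Integrable (fun v =>
      airyTransform a (2 * n - 2 - 2 * l) f v * airyTransform a (2 * l + 1) r v)
      (sigmaPrime ha.monotone) := fun l hl => by
    have hl := Finset.mem_range.1 hl
    exact ha.integrable_sigmaPrime (by omega) (by omega) hf hr
  refine (integral_finsetSum _ fun l hl => (h1 l hl).sub (h2 l hl)).trans ?_
  exact Finset.sum_congr rfl fun l hl => integral_sub (h1 l hl) (h2 l hl)

/-- Both pairings produce `∫ y f r`, by symmetry of the kernel form; only the inhomogeneity `a₀(t +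
y)` of the equation for `f` survives. -/
theorem integral_concomitant_eq (ha : IsWeightedAirySystem n ε s a σ) (hf : IsWeightedL2 f)
    (hr : IsWeightedL2 r) {t : ℝ}
    (hKf : ∀ᵐ y ∂halfLine,
      ∫ z, airyKernel a σ y z * f z ∂pointedHalfLine = f y - a 0 (t + y))
    (hKr : ∀ᵐ y ∂halfLine, ∫ z, airyKernel a σ y z * r z ∂pointedHalfLine = r y) :
    ∫ v, concomitant n a f r v ∂sigmaPrime ha.monotone
      = -(ε * airyTransform a 0 (fun y => y * r y) t) := by
  set D : ℝ → ℝ := fun v => airyTransform a (2 * n) f v * airyTransform a 0 r v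
    - airyTransform a 0 f v * airyTransform a (2 * n) r v with hD
  have hDmeas : StronglyMeasurable D :=
    ((ha.measurable_airyTransform _ hf.measurable).mul
      (ha.measurable_airyTransform _ hr.measurable)).sub
    ((ha.measurable_airyTransform _ hf.measurable).mul
      (ha.measurable_airyTransform _ hr.measurable))
  have hDdec : ExpDecay D :=
    ((ha.expDecay_airyTransform le_rfl hf.coweighted).mul
      (ha.expDecay_airyTransform (by omega) hr.coweighted)).sub
    ((ha.expDecay_airyTransform (by omega) hf.coweighted).mul
      (ha.expDecay_airyTransform le_rfl hr.coweighted))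
  have hDeq : ∀ v, D v = ε * (airyTransform a 0 (fun y => y * f y) v * airyTransform a 0 r v
      - airyTransform a 0 (fun y => y * r y) v * airyTransform a 0 f v) := fun v => by
    simp only [hD, ha.airyTransform_ode hf, ha.airyTransform_ode hr]
    ring
  -- Differentiability of transforms is available only below order `2n`, so the form of `D` with
  -- order-zero transforms is used. For `n = 0` the two terms of `D` cancel identically.
  have hDcont : Continuous D := by
    rcases Nat.eq_zero_or_pos n with rfl | hn
    · simp [hD, continuous_const]
    · have hc : ∀ {g : ℝ → ℝ}, IsCoweightedL2 g → Continuous (airyTransform a 0 g) := fun hg =>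
        continuous_iff_continuousAt.2 fun x =>
          (ha.hasDerivAt_airyTransform (by omega) hg x).continuousAt
      rw [funext hDeq]
      have := hc hf.coweighted
      have := hc hr.coweighted
      have := hc hf.coweighted_id_mul
      have := hc hr.coweighted_id_mul
      fun_prop
  obtain ⟨i1, e1⟩ := ha.pairing hf.coweighted_id_mul hr.coweighted
  obtain ⟨i2, e2⟩ := ha.pairing hr.coweighted_id_mul hf.coweighted
  have hσD : (fun v => σ v * D v) = fun v =>
      ε * (σ v * (airyTransform a 0 (fun y => y * f y) v * airyTransform a 0 r v)
      - σ v * (airyTransform a 0 (fun y => y * r y) v * airyTransform a 0 f v)) := by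
    funext v
    rw [hDeq]
    ring
  have hint : Integrable fun v => σ v * D v := by
    rw [hσD]
    exact (i1.sub i2).const_mul ε
  -- The equations for `f` and `r` are not needed at the atom, where the integrands carry a factor
  -- `y = 0`.
  have hae : ∀ {P : ℝ → Prop}, (∀ᵐ y ∂halfLine, P y) →
      ∀ᵐ y ∂pointedHalfLine, y = 0 ∨ P y := fun hP => by
    rw [ae_add_measure_iff]
    refine ⟨?_, hP.mono fun y hy => Or.inr hy⟩
    rw [ae_dirac_eq]
    exact Or.inl rfl
  have h1 : ∫ v, σ v * (airyTransform a 0 (fun y => y * f y) v * airyTransform a 0 r v)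
      = ∫ y, y * f y * r y ∂pointedHalfLine := by
    rw [e1]
    refine integral_congr_ae ?_
    filter_upwards [hae hKr] with y hy
    rcases hy with rfl | hy
    · simp
    · rw [hy]
  have h2 : ∫ v, σ v * (airyTransform a 0 (fun y => y * r y) v * airyTransform a 0 f v)
      = (∫ y, y * f y * r y ∂pointedHalfLine) - airyTransform a 0 (fun y => y * r y) t := by
    rw [e2, airyTransform, ← integral_sub (hf.integrable_id_mul_mul hr)
      (ha.integrable_airyTransform (by omega) hr.coweighted_id_mul t)]
    refine integral_congr_ae ?_
    filter_upwards [hae hKf] with y hy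
    rcases hy with rfl | hy
    · simp
    · rw [hy]
      ring
  have hFD : ∀ v, concomitant n a f r v = -∫ w in Ioi v, D w := fun v => by
    have hder := ha.hasDerivAt_concomitant hf.coweighted hr.coweighted
    rw [integral_Ioi_of_hasDerivAt_of_tendsto (hder v).continuousAt.continuousWithinAt
      (fun x _ => hder x) (hDdec.integrableOn_Ioi hDcont v) (ha.tendsto_concomitant hf.coweighted hr.coweighted)]
    ring
  simp_rw [hFD]
  rw [integral_neg, integral_sigmaPrime_tail ha.monotone ha.tendsto_atBot ha.nonneg hDmeas hint,
    hσD, integral_const_mul, integral_sub i1 i2, h1, h2]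
  ring

end IsWeightedAirySystem

/-! ### Weighted integrability of the resolvent functions. -/

theorem IsWeightedL2.memLp {h : ℝ → ℝ} (hh : IsWeightedL2 h) : MemLp h 2 halfLine :=
  (memLp_two_iff_integrable_sq hh.measurable.aestronglyMeasurable).2
    (integrable_pointedHalfLine_iff.1 hh.integrable_sq)

theorem isWeightedL2_of_ae_le {h b G : ℝ → ℝ} (hm : Measurable h) (hb : IsWeightedL2 b)
    (hG : IsWeightedL2 G) {C : ℝ} (hle : ∀ᵐ y ∂halfLine, |h y| ≤ |b y| + C * G y) :
    IsWeightedL2 h := by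
  refine ⟨hm, integrable_pointedHalfLine_iff.2 ?_⟩
  have h1 := integrable_pointedHalfLine_iff.1 ((hb.integrable.const_mul 2).fun_add
    (hG.integrable.const_mul (2 * C ^ 2)))
  refine h1.mono' (by fun_prop) ?_
  filter_upwards [hle] with y hy
  rw [Real.norm_of_nonneg (mul_nonneg (one_add_abs_pos y).le (sq_nonneg _))]
  have h2 : h y ^ 2 ≤ 2 * b y ^ 2 + 2 * C ^ 2 * G y ^ 2 := by
    have h3 : h y ^ 2 ≤ (|b y| + C * G y) ^ 2 := by
      rw [← sq_abs (h y)]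
      exact pow_le_pow_left₀ (abs_nonneg _) hy 2
    rw [← sq_abs (b y)]
    nlinarith [sq_nonneg (|b y| - C * G y)]
  have h4 := mul_le_mul_of_nonneg_left h2 (one_add_abs_pos y).le
  linarith

open Classical in
/-- The function equal to `f` on `(0, ∞)` and to `c` on `(-∞, 0]`. -/
noncomputable def extendHalfLine (c : ℝ) (f : ℝ → ℝ) (y : ℝ) : ℝ :=
  if 0 < y then f y else c

theorem extendHalfLine_zero (c : ℝ) (f : ℝ → ℝ) : extendHalfLine c f 0 = c := by
  simp [extendHalfLine]

theorem extendHalfLine_ae (c : ℝ) (f : ℝ → ℝ) :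
    ∀ᵐ y ∂halfLine, extendHalfLine c f y = f y := by
  filter_upwards [ae_restrict_mem measurableSet_Ioi] with y hy
  exact if_pos hy

theorem measurable_extendHalfLine (c : ℝ) {f : ℝ → ℝ} (hf : Measurable f) :
    Measurable (extendHalfLine c f) :=
  Measurable.ite measurableSet_Ioi hf measurable_const

theorem integral_mul_extendHalfLine {b : ℝ → ℝ} (c : ℝ) {f : ℝ → ℝ}
    (hi : Integrable (fun z => b z * f z) halfLine) :
    ∫ z, b z * extendHalfLine c f z ∂pointedHalfLine = b 0 * c + ∫ z, b z * f z ∂halfLine := by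
  have h1 : (fun z => b z * f z) =ᵐ[halfLine] fun z => b z * extendHalfLine c f z := by
    filter_upwards [extendHalfLine_ae c f] with z hz
    rw [hz]
  rw [integral_pointedHalfLine (hi.congr h1), extendHalfLine_zero, integral_congr_ae h1]

namespace IsWeightedAirySystem

variable {n : ℕ} {ε s : ℝ} {a : ℕ → ℝ → ℝ} {σ : ℝ → ℝ}

/-- The square root of the diagonal of `airyKernel`. -/
noncomputable def diagSqrt (a : ℕ → ℝ → ℝ) (σ : ℝ → ℝ) (x : ℝ) : ℝ :=
  √(∫ v, (√(σ v) * a 0 (v + x)) ^ 2)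

/-- For `x ≥ 0` monotonicity gives `σ(v) ≤ σ(v + x)`, and the hypothesis is then translated by `x`.
-/
theorem memLp_sqrt_mul (ha : IsWeightedAirySystem n ε s a σ) {x : ℝ} (hx : 0 ≤ x) :
    MemLp (fun v => √(σ v) * a 0 (v + x)) 2 := by
  have ham := ha.measurable 0
  have hσm := ha.monotone.measurable
  refine (memLp_two_iff_integrable_sq (by fun_prop)).2 ?_
  refine ((ha.integrable_sq 0 (by omega)).comp_add_right x).mono' (by fun_prop)
    (Eventually.of_forall fun v => ?_)
  rw [Real.norm_of_nonneg (sq_nonneg _), mul_pow, Real.sq_sqrt (ha.nonneg v)]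
  exact mul_le_mul_of_nonneg_right (ha.monotone (by linarith)) (sq_nonneg _)

theorem abs_airyKernel_le (ha : IsWeightedAirySystem n ε s a σ) {x y : ℝ} (hx : 0 ≤ x)
    (hy : 0 ≤ y) : |airyKernel a σ x y| ≤ diagSqrt a σ x * diagSqrt a σ y := by
  refine le_trans (le_of_eq ?_)
    (abs_integral_mul_le_sqrt_mul_sqrt (ha.memLp_sqrt_mul hx) (ha.memLp_sqrt_mul hy))
  unfold airyKernel
  congr 1
  refine integral_congr_ae (Eventually.of_forall fun v => ?_)
  simp only
  linear_combination (-a 0 (v + x) * a 0 (v + y)) * Real.mul_self_sqrt (ha.nonneg v)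

/-- By Tonelli, the weighted trace `∫ (1 + y) K(y, y)` is the double integral of
`lintegral_weight_lt_top`. -/
theorem isWeightedL2_diagSqrt (ha : IsWeightedAirySystem n ε s a σ) :
    IsWeightedL2 (diagSqrt a σ) := by
  have ham := ha.measurable 0
  have hσm := ha.monotone.measurable
  have hm : Measurable (diagSqrt a σ) := by
    have h1 : StronglyMeasurable
        (Function.uncurry fun x v : ℝ => (√(σ v) * a 0 (v + x)) ^ 2) := by
      apply Measurable.stronglyMeasurable
      unfold Function.uncurry
      fun_prop
    exact h1.integral_prod_right.measurable.sqrt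
  refine ⟨hm, by fun_prop, ?_⟩
  rw [hasFiniteIntegral_iff_ofReal (Eventually.of_forall fun y =>
    mul_nonneg (one_add_abs_pos y).le (sq_nonneg _))]
  refine lt_of_le_of_lt (le_of_eq ?_) ha.lintegral_weight_lt_top
  rw [lintegral_lintegral_swap (by
    apply Measurable.aemeasurable
    unfold Function.uncurry
    fun_prop)]
  refine lintegral_congr_ae ?_
  filter_upwards [ae_nonneg_pointedHalfLine] with y hy
  rw [diagSqrt, Real.sq_sqrt (integral_nonneg fun _ => sq_nonneg _),
    ENNReal.ofReal_mul (one_add_abs_pos y).le,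
    ofReal_integral_eq_lintegral_ofReal (ha.memLp_sqrt_mul hy).integrable_sq
      (Eventually.of_forall fun _ => sq_nonneg _), ← lintegral_const_mul' _ _ ENNReal.ofReal_ne_top]
  refine lintegral_congr fun v => ?_
  rw [← ENNReal.ofReal_mul (one_add_abs_pos y).le]
  congr 1
  linear_combination (-(√(σ v) * a 0 (v + y)) ^ 2) * Real.sq_sqrt (one_add_abs_pos y).le

theorem measurable_airyKernel (ha : IsWeightedAirySystem n ε s a σ) :
    Measurable (Function.uncurry (airyKernel a σ)) := by
  have ham := ha.measurable 0
  have hσm := ha.monotone.measurable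
  have h1 : StronglyMeasurable (Function.uncurry fun (x : ℝ × ℝ) (v : ℝ) =>
      σ v * a 0 (v + x.1) * a 0 (v + x.2)) := by
    apply Measurable.stronglyMeasurable
    unfold Function.uncurry
    fun_prop
  exact h1.integral_prod_right.measurable

theorem exists_isIntegralOperator_airyKernel (ha : IsWeightedAirySystem n ε s a σ) :
    ∃ T, IsIntegralOperator (airyKernel a σ) T :=
  exists_isIntegralOperator ha.measurable_airyKernel ha.isWeightedL2_diagSqrt.memLp
    (fun _ => Real.sqrt_nonneg _) fun _ _ hx hy => ha.abs_airyKernel_le hx.le hy.le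

theorem isWeightedL2_airy (ha : IsWeightedAirySystem n ε s a σ) (t : ℝ) :
    IsWeightedL2 fun y => a 0 (t + y) := by
  have hc := ha.continuous 0
  obtain ⟨C, c, hc0, hC, hle⟩ := ha.exists_abs_le (p := 0) (by omega) t
  have h1 : ExpDecay fun y => a 0 (t + y) := by
    refine ⟨c, hc0, Asymptotics.IsBigO.of_bound (C * Real.exp (-c * t)) ?_⟩
    filter_upwards [eventually_ge_atTop 0] with y hy
    rw [Real.norm_eq_abs, Real.norm_eq_abs, Real.abs_exp]
    exact hle t y le_rfl hy
  refine ⟨by fun_prop, integrable_pointedHalfLine_iff.2 ?_⟩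
  refine (((h1.mul h1).sub_const_mul (-1)).integrableOn_Ioi (by fun_prop) 0).congr ?_
  filter_upwards [ae_restrict_mem measurableSet_Ioi] with y hy
  rw [abs_of_pos hy]
  ring

theorem isWeightedL2_kernel_zero (ha : IsWeightedAirySystem n ε s a σ) :
    IsWeightedL2 fun y => airyKernel a σ y 0 := by
  have hG := ha.isWeightedL2_diagSqrt
  refine isWeightedL2_of_ae_le (b := fun _ => 0) (C := diagSqrt a σ 0)
    (ha.measurable_airyKernel.comp measurable_prodMk_right) ⟨by fun_prop, by simp⟩ hG ?_
  filter_upwards [ae_restrict_mem measurableSet_Ioi] with y hy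
  have := ha.abs_airyKernel_le (le_of_lt hy) le_rfl
  simp only [abs_zero]
  linarith

/-- A bootstrap: the equation and `abs_airyKernel_le` bound an `f` known only to be in `L²` by `|b|`
plus a multiple of `diagSqrt`, and both have the weighted integrability. -/
theorem isWeightedL2_extendHalfLine (ha : IsWeightedAirySystem n ε s a σ) {b : ℝ → ℝ}
    (hb : IsWeightedL2 b) (c : ℝ) {f : HalfLineL2}
    (hf : ∀ᵐ y ∂halfLine, f y = b y + ∫ z, airyKernel a σ y z * f z ∂halfLine) :
    IsWeightedL2 (extendHalfLine c f) := by
  have hG := ha.isWeightedL2_diagSqrt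
  refine isWeightedL2_of_ae_le (C := ∫ z, diagSqrt a σ z * ‖f z‖ ∂halfLine)
    (measurable_extendHalfLine c (Lp.stronglyMeasurable f).measurable) hb hG ?_
  filter_upwards [hf, extendHalfLine_ae c f, ae_restrict_mem measurableSet_Ioi] with y h1 h2 hy
  rw [h2, h1]
  refine (abs_add_le _ _).trans (add_le_add_right ?_ _)
  have h3 : ‖∫ z, airyKernel a σ y z * f z ∂halfLine‖
      ≤ ∫ z, diagSqrt a σ y * (diagSqrt a σ z * ‖f z‖) ∂halfLine := by
    refine norm_integral_le_of_norm_le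
      ((hG.memLp.integrable_mul (Lp.memLp f).norm).const_mul _) ?_
    filter_upwards [ae_restrict_mem measurableSet_Ioi] with z hz
    rw [norm_mul, ← mul_assoc]
    exact mul_le_mul_of_nonneg_right (ha.abs_airyKernel_le (le_of_lt hy) (le_of_lt hz))
      (norm_nonneg _)
  rw [integral_const_mul, mul_comm] at h3
  exact h3

theorem airyTransform_extendHalfLine (ha : IsWeightedAirySystem n ε s a σ) {p : ℕ}
    (hp : p ≤ 2 * n) {c : ℝ} {f : ℝ → ℝ} (hf : IsWeightedL2 (extendHalfLine c f)) (v : ℝ) :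
    airyTransform a p (extendHalfLine c f) v
      = a p v * c + ∫ z, a p (v + z) * f z ∂halfLine := by
  have h1 := integrable_pointedHalfLine_iff.1 (ha.integrable_airyTransform hp hf.coweighted v)
  have h2 : Integrable (fun z => a p (v + z) * f z) halfLine := by
    refine h1.congr ?_
    filter_upwards [extendHalfLine_ae c f] with z hz
    rw [hz]
  rw [airyTransform, integral_mul_extendHalfLine c h2, add_zero]

end IsWeightedAirySystem

/-! ### The resolvent equation and the conclusion. -/

theorem toHalfLineL2_ae_eq {f : ℝ → ℝ} (hf : MemLp f 2 halfLine) :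
    toHalfLineL2 f =ᵐ[halfLine] f := by
  rw [toHalfLineL2, dif_pos hf]
  exact hf.coeFn_toLp

theorem kernelK2_eq_airyKernel (A σ : ℝ → ℝ) (s : ℝ) :
    kernelK2 A σ s = airyKernel (fun p x => iteratedDeriv p A (s + x)) σ := by
  funext x y
  unfold kernelK2 airyKernel
  refine integral_congr_ae (Eventually.of_forall fun r => ?_)
  simp only [iteratedDeriv_zero]
  rw [show x + s + r = s + (r + x) by ring, show y + s + r = s + (r + y) by ring]

theorem resolvent_apply_ae {k : ℝ → ℝ → ℝ} {T : HalfLineL2 →L[ℝ] HalfLineL2}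
    (hT : IsIntegralOperator k T) (hinv : IsUnit (1 - T)) {b : ℝ → ℝ}
    (hb : MemLp b 2 halfLine) :
    ∀ᵐ y ∂halfLine,
      Integrable (fun z => k y z * Ring.inverse (1 - T) (toHalfLineL2 b) z) halfLine ∧
      Ring.inverse (1 - T) (toHalfLineL2 b) y
        = b y + ∫ z, k y z * Ring.inverse (1 - T) (toHalfLineL2 b) z ∂halfLine := by
  set f := Ring.inverse (1 - T) (toHalfLineL2 b) with hf
  have h1 : f = toHalfLineL2 b + T f := by
    have h2 := congrArg (fun S : HalfLineL2 →L[ℝ] HalfLineL2 => S (toHalfLineL2 b))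
      (Ring.mul_inverse_cancel _ hinv)
    simp only [mul_apply_eq_comp, sub_apply,
      one_apply_eq_self, ← hf] at h2
    rw [← h2]
    abel
  have h3 := Lp.coeFn_add (toHalfLineL2 b) (T f)
  rw [← h1] at h3
  filter_upwards [h3, hT f, toHalfLineL2_ae_eq hb] with y h4 h5 h6
  exact ⟨h5.1, by rw [h4, Pi.add_apply, h6, h5.2]⟩

theorem mainTheorem6 (n : ℕ) (A σ : ℝ → ℝ) (ε γ s : ℝ)
    (hε : ε = 1 ∨ ε = -1)
    (hA : ContDiff ℝ ∞ A)
    (hdecay : ∃ C c : ℝ, 0 < c ∧ ∀ x : ℝ, 0 ≤ x → |A x| ≤ C * Real.exp (-(c * x)))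
    (hODE : ∀ x : ℝ, iteratedDeriv (2 * n) A x = ε * (x * A x))
    (hσ : Monotone σ)
    (hσ_bot : Tendsto σ atBot (𝓝 0))
    (hσ_top : Tendsto σ atTop (𝓝 γ))
    (hγ : 0 < γ ∧ γ ≤ 1)
    (hL2 : ∀ p : ℕ, p ≤ 2 * n → Integrable (fun r : ℝ => σ r * (iteratedDeriv p A (s + r)) ^ 2))
    (hinv : IsUnit (1 - opK2 A σ s)) :
    (∀ t : ℝ, ∀ l ∈ Finset.range n,
      Integrable (fun v => uFun A σ s (2 * n - 1 - 2 * l) v t * qFun A σ s (2 * l) v)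
        (sigmaPrime hσ) ∧
      Integrable (fun v => uFun A σ s (2 * n - 2 - 2 * l) v t * qFun A σ s (2 * l + 1) v)
        (sigmaPrime hσ)) ∧
    ∀ t : ℝ,
      qFun A σ s (2 * n) t =
        ε * ((s + t) * qFun A σ s 0 t)
          - ∑ l ∈ Finset.range n,
              (uTransposeSigmaQ A hσ s (2 * n - 1 - 2 * l) (2 * l) t
                - uTransposeSigmaQ A hσ s (2 * n - 2 - 2 * l) (2 * l + 1) t) := by
  set a : ℕ → ℝ → ℝ := fun p x => iteratedDeriv p A (s + x) with ha_def
  have ha : IsWeightedAirySystem n ε s a σ :=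
    ⟨isAirySystem_iteratedDeriv s hε hA hdecay hODE, hσ, hσ_bot, hL2⟩
  have hK : kernelK2 A σ s = airyKernel a σ := kernelK2_eq_airyKernel A σ s
  obtain ⟨T, hT⟩ := ha.exists_isIntegralOperator_airyKernel
  -- The kernel does define a bounded operator, so the default value `0` of `integralOperator` does
  -- not intervene.
  have hop : opK2 A σ s = T := by
    rw [opK2, hK]
    exact integralOperator_eq hT
  rw [hop] at hinv
  have hres : resolventK2 A σ s = Ring.inverse (1 - T) := by rw [resolventK2, hop]
  have hshift : ∀ p v z, iteratedDeriv p A (v + s + z) = a p (v + z) := fun p v z => by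
    rw [ha_def, show v + s + z = s + (v + z) by ring]
  have hδ : (fun y => kernelK2 A σ s y 0) = fun y => airyKernel a σ y 0 := by rw [hK]
  set ρ := resolventDelta A σ s with hρ_def
  have hρ := hρ_def
  rw [resolventDelta, hres, hδ] at hρ
  have eρ := resolvent_apply_ae hT hinv ha.isWeightedL2_kernel_zero.memLp
  rw [← hρ] at eρ
  -- The value `1` at the atom encodes the `δ` in `δ + ρ`; its image `K(·, 0)` is the inhomogeneous
  -- term of the equation for `ρ`, which turns into `K r = r`.
  have wρ : IsWeightedL2 (extendHalfLine 1 ρ) :=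
    ha.isWeightedL2_extendHalfLine ha.isWeightedL2_kernel_zero 1 (eρ.mono fun _ h => h.2)
  have hq : ∀ p ≤ 2 * n, ∀ v, qFun A σ s p v = airyTransform a p (extendHalfLine 1 ρ) v :=
    fun p hp v => by
      rw [ha.airyTransform_extendHalfLine hp wρ, mul_one, qFun, ← hρ_def, add_comm v s]
      simp_rw [add_comm s v, hshift]
      rw [add_comm v s]
  have hA_t : ∀ t, (fun z => A (z + t + s)) = fun z => a 0 (t + z) := fun t => by
    funext z
    rw [← hshift, iteratedDeriv_zero, show z + t + s = t + s + z by ring]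
  have key : ∀ t, ∃ f : ℝ → ℝ, IsWeightedL2 f ∧
      (∀ p ≤ 2 * n, ∀ v, uFun A σ s p v t = airyTransform a p f v) ∧
      ∀ᵐ y ∂halfLine, ∫ z, airyKernel a σ y z * f z ∂pointedHalfLine = f y - a 0 (t + y) := by
    intro t
    have ef := resolvent_apply_ae hT hinv (ha.isWeightedL2_airy t).memLp
    set f := Ring.inverse (1 - T) (toHalfLineL2 fun y => a 0 (t + y)) with hf
    have wf : IsWeightedL2 (extendHalfLine 0 f) :=
      ha.isWeightedL2_extendHalfLine (ha.isWeightedL2_airy t) 0 (ef.mono fun _ h => h.2)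
    refine ⟨extendHalfLine 0 f, wf, fun p hp v => ?_, ?_⟩
    · rw [ha.airyTransform_extendHalfLine hp wf, mul_zero, zero_add, uFun, hres, hA_t, ← hf]
      simp_rw [hshift]
    · filter_upwards [ef, extendHalfLine_ae 0 f] with y h1 h2
      rw [integral_mul_extendHalfLine 0 h1.1, h2, h1.2]
      ring
  have hKr : ∀ᵐ y ∂halfLine,
      ∫ z, airyKernel a σ y z * extendHalfLine 1 ρ z ∂pointedHalfLine = extendHalfLine 1 ρ y := by
    filter_upwards [eρ, extendHalfLine_ae 1 ρ] with y h1 h2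
    rw [integral_mul_extendHalfLine 1 h1.1, h2, h1.2, mul_one]
  refine ⟨fun t l hl => ?_, fun t => ?_⟩
  · have hl := Finset.mem_range.1 hl
    obtain ⟨f, wf, hu, -⟩ := key t
    simp_rw [hu (2 * n - 1 - 2 * l) (by omega), hu (2 * n - 2 - 2 * l) (by omega),
      hq (2 * l) (by omega), hq (2 * l + 1) (by omega)]
    exact ⟨ha.integrable_sigmaPrime (by omega) (by omega) wf wρ,
      ha.integrable_sigmaPrime (by omega) (by omega) wf wρ⟩
  · obtain ⟨f, wf, hu, hKf⟩ := key t
    have hsum : ∑ l ∈ Finset.range n,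
        (uTransposeSigmaQ A hσ s (2 * n - 1 - 2 * l) (2 * l) t
          - uTransposeSigmaQ A hσ s (2 * n - 2 - 2 * l) (2 * l + 1) t)
        = -(ε * airyTransform a 0 (fun y => y * extendHalfLine 1 ρ y) t) := by
      rw [← ha.integral_concomitant_eq wf wρ hKf hKr, ha.integral_concomitant wf wρ]
      refine Finset.sum_congr rfl fun l hl => ?_
      have hl := Finset.mem_range.1 hl
      unfold uTransposeSigmaQ
      simp_rw [hu (2 * n - 1 - 2 * l) (by omega), hu (2 * n - 2 - 2 * l) (by omega),
        hq (2 * l) (by omega), hq (2 * l + 1) (by omega)]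
    rw [hsum, hq _ le_rfl, hq 0 (by omega), ha.airyTransform_ode wρ]
    ring
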